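/- Throughout, a six-dimensional almost abelian Lie group is a connected and simply connected real Lie group $G$ of dimension $6$ whose Lie algebra $\mathfrak g$ has an abelian ideal of codimension one. Left-invariant tensors on $G$ are identified with tensors on $\mathfrak g$, and $d$ is the (Chevalley–Eilenberg) exterior derivative of left-invariant forms. A Hermitian structure on $\mathfrak g$ is a pair $(J,g)$ with $J\in\operatorname{End}(\mathfrak g)$, $J^2=-1$, $[Jx,Jy]-J[Jx,y]-J[x,Jy]-[x,y]=0$ for all $x,y$, and $g$ an inner product with $g(Jx,Jy)=g(x,y)$; its fundamental form is $\omega(x,y)=g(Jx,y)$, and $d^c=-JdJ$, where $(J\alpha)(x_1,\dots,x_k)=(-1)^k\alpha(Jx_1,\dots,Jx_k)$ on $k$-forms. It is Kähler if $d\omega=0$. A generalized Kähler structure is a triple $(J_+,J_-,g)$ such that $(J_+,g)$ and $(J_-,g)$ are Hermitian, with fundamental forms $\omega_\pm$, and $$d^c_+\omega_++d^c_-\omega_-=0,\qquad dd^c_+\omega_+=dd^c_-\omega_-=0;$$ it is split if $J_+J_-=J_-J_+$. We write $\mathfrak g=(\alpha_1,\dots,\alpha_6)$ for the Lie algebra with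 basis $f_1,\dots,f_6$ and dual basis $f^1,\dots,f^6$ such that $df^i=\alpha_i$, and $f^{ij}=f^i\wedge f^j$. **Theorem.** Let $G$ be a six-dimensional almost abelian Lie group. Then $G$ admits a left-invariant split generalized Kähler structure but no left-invariant Kähler structure if and only if its Lie algebra is isomorphic to one of the following: 1. $\mathfrak k_1^{-\frac12,-\frac12}=(f^{16},-\frac12f^{26},-\frac12f^{36},-\frac12f^{46},-\frac12f^{56},0)$; 2. $\mathfrak k_8^{p,-\frac p2,0}=(pf^{16},-\frac p2f^{26},-\frac p2f^{36},f^{56},-f^{46},0)$, $p\neq0$; 3. $\mathfrak k_8^{p,-\frac p2,-\frac p2}=(pf^{16},-\frac p2f^{26},-\frac p2f^{36},-\frac p2f^{46}+f^{56},-f^{46}-\frac p2f^{56},0)$, $p\neq0$; 4. $\mathfrak k_{11}^{p,-\frac p2,0,s}=(pf^{16},-\frac p2f^{26}+f^{36},-f^{26}-\frac p2f^{36},sf^{56},-sf^{46},0)$, $p\neq0$, $s\neq0$; 5. $\mathfrak k_{11}^{p,-\frac p2,-\frac p2,s}=(pf^{16},-\frac p2f^{26}+f^{36},-f^{26}-\frac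 p2f^{36},-\frac p2f^{46}+sf^{56},-sf^{46}-\frac p2f^{56},0)$, $p\neq0$, $1\geq|s|>0$; 6. $\mathfrak k_{17}^{-\frac12}=(f^{16},-\frac12f^{26},-\frac12f^{36},0,0,0)$; 7. $\mathfrak k_{19}^{p,-\frac p2}=(pf^{16},-\frac p2f^{26}+f^{36},-f^{26}-\frac p2f^{36},0,0,0)$, $p\neq0$. Here $p,s$ are real numbers. Likewise, a six-dimensional real Lie algebra with an abelian ideal of codimension one admits a split generalized Kähler structure but no Kähler structure if and only if it is isomorphic to one of these. On each of the Lie algebras 1–7, a split generalized Kähler structure $(J_+,J_-,g)$ is given by $g=\sum_{i=1}^6f^i\otimes f^i$ and $$J_\pm f_1=f_6,\qquad J_\pm f_2=\pm f_3,\qquad J_\pm f_4=\pm f_5 .$$ Among them, exactly $\mathfrak k_8^{p,-\frac p2,0}$, $\mathfrak k_{11}^{p,-\frac p2,0,s}$, $\mathfrak k_{17}^{-\frac12}$ and $\mathfrak k_{19}^{p,-\frac p2}$ are unimodular (i.e. satisfy $\operatorname{tr}\operatorname{ad}_x=0$ for all $x$). -/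

import Mathlib

open scoped Manifold ContDiff

namespace AlmostAbelian

/-! ### Left-invariant tensors, as tensors on a real Lie algebra -/

section Structures

variable {L : Type*} [LieRing L] [LieAlgebra ℝ L]

/-- A Lie algebra is almost abelian if it has an abelian ideal of codimension one. -/
def IsAlmostAbelian (L : Type*) [LieRing L] [LieAlgebra ℝ L] : Prop :=
  ∃ I : LieIdeal ℝ L, (∀ x ∈ I, ∀ y ∈ I, ⁅x, y⁆ = 0) ∧ Module.finrank ℝ (L ⧸ I) = 1

/-- A Lie algebra is unimodular if `tr (ad x) = 0` for every `x`. -/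
def IsUnimodular (L : Type*) [LieRing L] [LieAlgebra ℝ L] : Prop :=
  ∀ x : L, LinearMap.trace ℝ L (LieAlgebra.ad ℝ L x : Module.End ℝ L) = 0

/-- `J` is an (integrable) complex structure: `J ^ 2 = -1` and the Nijenhuis tensor vanishes. -/
structure IsComplexStructure (J : L →ₗ[ℝ] L) : Prop where
  sq : ∀ x, J (J x) = -x
  nijenhuis : ∀ x y, ⁅J x, J y⁆ - J ⁅J x, y⁆ - J ⁅x, J y⁆ - ⁅x, y⁆ = 0

/-- `(J, g)` is Hermitian: `J` is a complex structure and `g` is a `J`-invariant inner product. -/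
structure IsHermitian (J : L →ₗ[ℝ] L) (g : L →ₗ[ℝ] L →ₗ[ℝ] ℝ) : Prop where
  complex : IsComplexStructure J
  symm : ∀ x y, g x y = g y x
  pos : ∀ x, x ≠ 0 → 0 < g x x
  compat : ∀ x y, g (J x) (J y) = g x y

/-- The fundamental form `ω(x, y) = g(J x, y)`. -/
def fundamentalForm (J : L →ₗ[ℝ] L) (g : L →ₗ[ℝ] L →ₗ[ℝ] ℝ) : L → L → ℝ :=
  fun x y => g (J x) y

/-- The exterior derivative of a left-invariant 2-form. -/
def d₂ (om : L → L → ℝ) : L → L → L → ℝ :=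
  fun x y z => -om ⁅x, y⁆ z + om ⁅x, z⁆ y - om ⁅y, z⁆ x

/-- The exterior derivative of a left-invariant 3-form. -/
def d₃ (η : L → L → L → ℝ) : L → L → L → L → ℝ :=
  fun x y z w =>
    -η ⁅x, y⁆ z w + η ⁅x, z⁆ y w - η ⁅x, w⁆ y z
      - η ⁅y, z⁆ x w + η ⁅y, w⁆ x z - η ⁅z, w⁆ x y

/-- The operator `d^c = -J d J` on 2-forms, where `J` acts on a `k`-form `α` by
`(J α)(x₁, …, x_k) = (-1)^k α(J x₁, …, J x_k)`. -/
def dc₂ (J : L →ₗ[ℝ] L) (om : L → L → ℝ) : L → L → L → ℝ :=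
  fun x y z => -(-(d₂ (fun u v => om (J u) (J v)) (J x) (J y) (J z)))

/-- `(J, g)` is Kähler: Hermitian with closed fundamental form. -/
def IsKahler (J : L →ₗ[ℝ] L) (g : L →ₗ[ℝ] L →ₗ[ℝ] ℝ) : Prop :=
  IsHermitian J g ∧ ∀ x y z, d₂ (fundamentalForm J g) x y z = 0

/-- `(J₊, J₋, g)` is a generalized Kähler structure (in bi-Hermitian form): both `(J₊, g)` and
`(J₋, g)` are Hermitian, `d^c₊ ω₊ + d^c₋ ω₋ = 0` and `d d^c₊ ω₊ = d d^c₋ ω₋ = 0`. -/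
structure IsGeneralizedKahler (Jp Jm : L →ₗ[ℝ] L) (g : L →ₗ[ℝ] L →ₗ[ℝ] ℝ) : Prop where
  hermitian_plus : IsHermitian Jp g
  hermitian_minus : IsHermitian Jm g
  torsion : ∀ x y z,
    dc₂ Jp (fundamentalForm Jp g) x y z + dc₂ Jm (fundamentalForm Jm g) x y z = 0
  skt_plus : ∀ x y z w, d₃ (dc₂ Jp (fundamentalForm Jp g)) x y z w = 0
  skt_minus : ∀ x y z w, d₃ (dc₂ Jm (fundamentalForm Jm g)) x y z w = 0

/-- A generalized Kähler structure is split if `J₊` and `J₋` commute. -/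
def IsSplitGeneralizedKahler (Jp Jm : L →ₗ[ℝ] L) (g : L →ₗ[ℝ] L →ₗ[ℝ] ℝ) : Prop :=
  IsGeneralizedKahler Jp Jm g ∧ ∀ x, Jp (Jm x) = Jm (Jp x)

/-- The Lie algebra carries a Kähler structure. -/
def AdmitsKahler (L : Type*) [LieRing L] [LieAlgebra ℝ L] : Prop :=
  ∃ (J : L →ₗ[ℝ] L) (g : L →ₗ[ℝ] L →ₗ[ℝ] ℝ), IsKahler J g

/-- The Lie algebra carries a split generalized Kähler structure. -/
def AdmitsSplitGeneralizedKahler (L : Type*) [LieRing L] [LieAlgebra ℝ L] : Prop :=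
  ∃ (Jp Jm : L →ₗ[ℝ] L) (g : L →ₗ[ℝ] L →ₗ[ℝ] ℝ), IsSplitGeneralizedKahler Jp Jm g

end Structures

/-! ### The Lie algebras `ℝ⁵ ⋊ ℝ` given by structure equations -/

/-- The six-dimensional Lie algebra with basis `f₁, …, f₆` (indexed by `0, …, 5`) in which
`f₁, …, f₅` commute and `[f₆, fⱼ] = ∑ᵢ Bᵢⱼ fᵢ` for `j ≤ 5`. In terms of the dual basis, the
structure equations are `df^i = ∑ⱼ Bᵢⱼ f^j ∧ f^6` for `i ≤ 5` and `df^6 = 0`; so the rows of `B` list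
`df^1, …, df^5`. -/
def Model (_B : Matrix (Fin 5) (Fin 5) ℝ) : Type := Fin 6 → ℝ

namespace Model

variable {B : Matrix (Fin 5) (Fin 5) ℝ}

noncomputable instance : AddCommGroup (Model B) := inferInstanceAs (AddCommGroup (Fin 6 → ℝ))

noncomputable instance : Module ℝ (Model B) := inferInstanceAs (Module ℝ (Fin 6 → ℝ))

/-- The coordinate `f^i` of a vector. -/
def coord (x : Model B) (i : Fin 6) : ℝ := x i

@[ext] theorem ext {x y : Model B} (h : ∀ i, x.coord i = y.coord i) : x = y := funext h

@[simp] theorem coord_add (x y : Model B) (i : Fin 6) :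
    (x + y).coord i = x.coord i + y.coord i := rfl

@[simp] theorem coord_smul (c : ℝ) (x : Model B) (i : Fin 6) :
    (c • x).coord i = c * x.coord i := rfl

@[simp] theorem coord_zero (i : Fin 6) : (0 : Model B).coord i = 0 := rfl

/-- `f^i [x, y] = -df^i (x, y) = -∑ⱼ Bᵢⱼ (xⱼ y₆ - x₆ yⱼ)` for `i ≤ 5`, and `f^6 [x, y] = 0`. -/
noncomputable instance : Bracket (Model B) (Model B) where
  bracket x y := (Fin.snoc (α := fun _ => ℝ)
    (fun i : Fin 5 => -∑ j : Fin 5, B i j *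
      (x.coord j.castSucc * y.coord 5 - x.coord 5 * y.coord j.castSucc))
    0 : Fin 6 → ℝ)

@[simp] theorem coord_lie_castSucc (x y : Model B) (i : Fin 5) :
    (⁅x, y⁆ : Model B).coord i.castSucc = -∑ j : Fin 5, B i j *
      (x.coord j.castSucc * y.coord 5 - x.coord 5 * y.coord j.castSucc) :=
  Fin.snoc_castSucc (n := 5) (α := fun _ : Fin 6 => ℝ) (0 : ℝ) (fun i : Fin 5 =>
    -∑ j : Fin 5, B i j * (x.coord j.castSucc * y.coord 5 - x.coord 5 * y.coord j.castSucc)) i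

@[simp] theorem coord_lie_last (x y : Model B) :
    (⁅x, y⁆ : Model B).coord 5 = 0 :=
  Fin.snoc_last (n := 5) (α := fun _ : Fin 6 => ℝ) (0 : ℝ) (fun i : Fin 5 =>
    -∑ j : Fin 5, B i j * (x.coord j.castSucc * y.coord 5 - x.coord 5 * y.coord j.castSucc))

noncomputable instance : LieRing (Model B) where
  add_lie x y z := by
    ext i
    refine Fin.lastCases (by simp) (fun i => ?_) i
    simp only [coord_lie_castSucc, coord_add, Fin.sum_univ_five]
    ring
  lie_add x y z := by
    ext i
    refine Fin.lastCases (by simp) (fun i => ?_) i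
    simp only [coord_lie_castSucc, coord_add, Fin.sum_univ_five]
    ring
  lie_self x := by
    ext i
    refine Fin.lastCases (by simp) (fun i => ?_) i
    simp only [coord_lie_castSucc, coord_zero, Fin.sum_univ_five]
    ring
  leibniz_lie x y z := by
    ext i
    refine Fin.lastCases (by simp) (fun i => ?_) i
    simp only [coord_lie_castSucc, coord_lie_last, coord_add, Fin.sum_univ_five]
    ring

noncomputable instance : LieAlgebra ℝ (Model B) where
  lie_smul c x y := by
    ext i
    refine Fin.lastCases (by simp) (fun i => ?_) i
    simp only [coord_lie_castSucc, coord_smul, Fin.sum_univ_five]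
    ring

/-- The endomorphism with a given matrix in the basis `f₁, …, f₆`. -/
noncomputable def ofMatrix (M : Matrix (Fin 6) (Fin 6) ℝ) : Model B →ₗ[ℝ] Model B where
  toFun x := M.mulVec x.coord
  map_add' x y := M.mulVec_add x.coord y.coord
  map_smul' c x := M.mulVec_smul c x.coord

/-- The complex structure `J₊ f₁ = f₆, J₊ f₂ = f₃, J₊ f₄ = f₅`. -/
noncomputable def Jplus : Model B →ₗ[ℝ] Model B := ofMatrix
  !![0, 0, 0, 0, 0, -1;
     0, 0, -1, 0, 0, 0;
     0, 1, 0, 0, 0, 0;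
     0, 0, 0, 0, -1, 0;
     0, 0, 0, 1, 0, 0;
     1, 0, 0, 0, 0, 0]

/-- The complex structure `J₋ f₁ = f₆, J₋ f₂ = -f₃, J₋ f₄ = -f₅`. -/
noncomputable def Jminus : Model B →ₗ[ℝ] Model B := ofMatrix
  !![0, 0, 0, 0, 0, -1;
     0, 0, 1, 0, 0, 0;
     0, -1, 0, 0, 0, 0;
     0, 0, 0, 0, 1, 0;
     0, 0, 0, -1, 0, 0;
     1, 0, 0, 0, 0, 0]

/-- The inner product `∑ᵢ f^i ⊗ f^i`. -/
noncomputable def stdMetric : Model B →ₗ[ℝ] Model B →ₗ[ℝ] ℝ :=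
  LinearMap.mk₂ ℝ (fun x y => ∑ i, x.coord i * y.coord i)
    (fun x y z => by simp [add_mul, Finset.sum_add_distrib])
    (fun c x y => by simp [Finset.mul_sum, mul_assoc])
    (fun x y z => by simp [mul_add, Finset.sum_add_distrib])
    (fun c x y => by simp [Finset.mul_sum, mul_left_comm])

end Model

/-! ### The families of Lie algebras -/

/-- `𝔨₁^{p,r} = (f¹⁶, p f²⁶, p f³⁶, r f⁴⁶, r f⁵⁶, 0)` -/
abbrev k1 (p r : ℝ) : Type := Model
  !![1, 0, 0, 0, 0;
     0, p, 0, 0, 0;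
     0, 0, p, 0, 0;
     0, 0, 0, r, 0;
     0, 0, 0, 0, r]

/-- `𝔨₈^{p,q,s} = (p f¹⁶, q f²⁶, q f³⁶, s f⁴⁶ + f⁵⁶, -f⁴⁶ + s f⁵⁶, 0)` -/
abbrev k8 (p q s : ℝ) : Type := Model
  !![p, 0, 0, 0, 0;
     0, q, 0, 0, 0;
     0, 0, q, 0, 0;
     0, 0, 0, s, 1;
     0, 0, 0, -1, s]

/-- `𝔨₁₁^{p,q,r,s} = (p f¹⁶, q f²⁶ + f³⁶, -f²⁶ + q f³⁶, r f⁴⁶ + s f⁵⁶, -s f⁴⁶ + r f⁵⁶, 0)` -/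
abbrev k11 (p q r s : ℝ) : Type := Model
  !![p, 0, 0, 0, 0;
     0, q, 1, 0, 0;
     0, -1, q, 0, 0;
     0, 0, 0, r, s;
     0, 0, 0, -s, r]

/-- `𝔨₁₇^p = (f¹⁶, p f²⁶, p f³⁶, 0, 0, 0)` -/
abbrev k17 (p : ℝ) : Type := Model
  !![1, 0, 0, 0, 0;
     0, p, 0, 0, 0;
     0, 0, p, 0, 0;
     0, 0, 0, 0, 0;
     0, 0, 0, 0, 0]

/-- `𝔨₁₉^{p,q} = (p f¹⁶, q f²⁶ + f³⁶, -f²⁶ + q f³⁶, 0, 0, 0)` -/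
abbrev k19 (p q : ℝ) : Type := Model
  !![p, 0, 0, 0, 0;
     0, q, 1, 0, 0;
     0, -1, q, 0, 0;
     0, 0, 0, 0, 0;
     0, 0, 0, 0, 0]

/-- `L` is isomorphic to a member of one of the seven families. -/
def IsInList (L : Type*) [LieRing L] [LieAlgebra ℝ L] : Prop :=
  Nonempty (L ≃ₗ⁅ℝ⁆ k1 (-1 / 2) (-1 / 2)) ∨
  (∃ p : ℝ, p ≠ 0 ∧ Nonempty (L ≃ₗ⁅ℝ⁆ k8 p (-p / 2) 0)) ∨
  (∃ p : ℝ, p ≠ 0 ∧ Nonempty (L ≃ₗ⁅ℝ⁆ k8 p (-p / 2) (-p / 2))) ∨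
  (∃ p s : ℝ, p ≠ 0 ∧ s ≠ 0 ∧ Nonempty (L ≃ₗ⁅ℝ⁆ k11 p (-p / 2) 0 s)) ∨
  (∃ p s : ℝ, p ≠ 0 ∧ 0 < |s| ∧ |s| ≤ 1 ∧ Nonempty (L ≃ₗ⁅ℝ⁆ k11 p (-p / 2) (-p / 2) s)) ∨
  Nonempty (L ≃ₗ⁅ℝ⁆ k17 (-1 / 2)) ∨
  (∃ p : ℝ, p ≠ 0 ∧ Nonempty (L ≃ₗ⁅ℝ⁆ k19 p (-p / 2)))

/-! ### Lie groups -/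

instance : ENat.LEInfty (minSmoothness ℝ 3) := ⟨by
  rw [minSmoothness_of_isRCLikeNormedField]
  exact ENat.LEInfty.out⟩

section Group

variable (G : Type*) [TopologicalSpace G] [ChartedSpace (EuclideanSpace ℝ (Fin 6)) G] [Group G]
  [LieGroup (𝓡 6) ∞ G]

/-- An almost abelian Lie group of dimension six: a connected and simply connected Lie group whose
Lie algebra has an abelian ideal of codimension one. -/
def IsAlmostAbelianGroup : Prop :=
  SimplyConnectedSpace G ∧ IsAlmostAbelian (GroupLieAlgebra (𝓡 6) G)

/-- `G` has a left-invariant Kähler structure; left-invariant tensors on `G` are those induced by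
tensors on the Lie algebra of left-invariant vector fields. -/
def AdmitsLeftInvariantKahler : Prop := AdmitsKahler (GroupLieAlgebra (𝓡 6) G)

/-- `G` has a left-invariant split generalized Kähler structure. -/
def AdmitsLeftInvariantSplitGK : Prop :=
  AdmitsSplitGeneralizedKahler (GroupLieAlgebra (𝓡 6) G)

end Group

end AlmostAbelian

open AlmostAbelian

/-! Fix the abelian ideal `I` and a unit normal `e`. All brackets are determined by D = ad e. Put e₁
= -Je, a = g(e₁, De₁) and let N be the orthogonal complement of e and Je. Integrability makes D
preserve N and commute with J there, so D is complex linear on the complex plane N. The pluriclosed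
condition restricts the symmetric part of D on N; applied to a unitary triangularisation, it kills
the off-diagonal entry and forces each diagonal real part to be 0 or -a/2 (`eq_zero_of_normality`,
`exists_isAdaptedFrame`).

If a ≠ 0, then a is not an eigenvalue of D on N, so e₁ can be shifted by N to an eigenvector, and
the Lie algebra is given by a block matrix a ⊕ (b, t) ⊕ (c, s) (`nonempty_equiv_of_ne_zero`). If b =
c = 0 it is Kähler; otherwise rescaling D and exchanging the planes gives the list (`isInList_iff`).
If a = 0, then b = c = 0 and D is skew away from e₁; the opposite torsions of the two structures
force De₁ = 0 (`lie_neg_J_eq_zero`), and the algebra is again Kähler.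

Conversely, on a block matrix the standard torsions are opposite combinations of f¹²³ and f¹⁴⁵,
closed exactly because of the relation between real parts. No Kähler form exists: a closed 2-form
pairs two D-invariant subspaces of `I` to zero unless real parts of eigenvalues cancel, so a whole
plane would pair only with the line of f₆, contradicting nondegeneracy (`not_admitsKahler`). -/

namespace AlmostAbelian

/-! ### Hermitian almost abelian Lie algebras -/

/-- A linear complex structure makes every commuting endomorphism have a complex eigenvector. -/
theorem exists_complex_eigenvector {V : Type*} [AddCommGroup V] [Module ℝ V]
    [FiniteDimensional ℝ V] [Nontrivial V] (J A : Module.End ℝ V) (hJ : ∀ x, J (J x) = -x)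
    (hA : ∀ x, A (J x) = J (A x)) :
    ∃ x : V, x ≠ 0 ∧ ∃ b t : ℝ, A x = b • x + t • J x := by
  have hJJ : J * J = -1 := by
    ext x; simp [hJ]
  -- `J` defines a complex vector space structure for which `A` is complex linear; b + it is then an
  -- eigenvalue of `A` over ℂ.
  let φ : ℂ →ₐ[ℝ] Module.End ℝ V := Complex.lift ⟨J, hJJ⟩
  let _ : Module ℂ V := Module.compHom V φ.toRingHom
  have hsmul : ∀ (z : ℂ) (x : V), z • x = z.re • x + z.im • J x := by
    intro z x
    change φ z x = _
    simp [φ, Complex.liftAux_apply, Module.algebraMap_end_apply]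
  have : IsScalarTower ℝ ℂ V := by
    refine ⟨fun r z x => ?_⟩
    simp [hsmul, smul_add, mul_smul]
  have : FiniteDimensional ℂ V := Module.Finite.of_restrictScalars_finite ℝ ℂ V
  let A' : Module.End ℂ V :=
    { toFun := A
      map_add' := A.map_add
      map_smul' := fun z x => by simp [hsmul, hA] }
  obtain ⟨μ, hμ⟩ := Module.End.exists_eigenvalue A'
  obtain ⟨x, hx⟩ := hμ.exists_hasEigenvector
  exact ⟨x, hx.2, μ.re, μ.im, by rw [← hsmul]; exact hx.apply_eq_smul⟩

section Hermitian

variable {L : Type*} [LieRing L] [LieAlgebra ℝ L]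

/-- The vector `e` is a unit normal, with respect to `g`, of the abelian ideal `I`. -/
structure IsUnitNormal (I : LieIdeal ℝ L) (g : L →ₗ[ℝ] L →ₗ[ℝ] ℝ) (e : L) : Prop where
  abelian : ∀ x ∈ I, ∀ y ∈ I, ⁅x, y⁆ = 0
  mem_iff : ∀ x, x ∈ I ↔ g e x = 0
  unit : g e e = 1

/-- By dimension the map from `L` to the dual of `I` induced by `g` has a kernel; a normalised
kernel vector works, since `I` and its orthogonal hyperplane have the same dimension. -/
theorem exists_isUnitNormal [FiniteDimensional ℝ L] {I : LieIdeal ℝ L}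
    (hI : ∀ x ∈ I, ∀ y ∈ I, ⁅x, y⁆ = 0) (hq : Module.finrank ℝ (L ⧸ I) = 1)
    {g : L →ₗ[ℝ] L →ₗ[ℝ] ℝ} (pos : ∀ x, x ≠ 0 → 0 < g x x) :
    ∃ e, IsUnitNormal I g e := by
  have hdim : Module.finrank ℝ (L ⧸ I.toSubmodule) + Module.finrank ℝ I.toSubmodule
      = Module.finrank ℝ L := I.toSubmodule.finrank_quotient_add_finrank
  have hq' : Module.finrank ℝ (L ⧸ I.toSubmodule) = 1 := hq
  let ψ : L →ₗ[ℝ] Module.Dual ℝ I.toSubmodule := (Submodule.dualRestrict I.toSubmodule).comp g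
  have hker : LinearMap.ker ψ ≠ ⊥ := by
    apply LinearMap.ker_ne_bot_of_finrank_lt
    rw [Subspace.dual_finrank_eq]
    omega
  obtain ⟨x, hx, hx0⟩ := (Submodule.ne_bot_iff _).1 hker
  have hxI : ∀ y ∈ I, g x y = 0 := fun y hy =>
    LinearMap.congr_fun (LinearMap.mem_ker.1 hx) ⟨y, hy⟩
  have hp := pos x hx0
  set r := Real.sqrt (g x x) with hr
  have hr0 : r ≠ 0 := (Real.sqrt_pos.2 hp).ne'
  have hrr : r * r = g x x := Real.mul_self_sqrt hp.le
  have hunit : g (r⁻¹ • x) (r⁻¹ • x) = 1 := by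
    simp only [map_smul, LinearMap.smul_apply, smul_eq_mul, ← hrr]
    field_simp
  have hle : I.toSubmodule ≤ LinearMap.ker (g (r⁻¹ • x)) := fun y hy => by
    simp [hxI y hy]
  have hfr : Module.finrank ℝ (LinearMap.ker (g (r⁻¹ • x))) + 1 = Module.finrank ℝ L := by
    have hne : g (r⁻¹ • x) ≠ 0 := fun h => by simp [h] at hunit
    exact Module.Dual.finrank_ker_add_one_of_ne_zero hne
  have heq : I.toSubmodule = LinearMap.ker (g (r⁻¹ • x)) :=
    Submodule.eq_of_le_of_finrank_eq hle (by omega)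
  refine ⟨r⁻¹ • x, hI, fun y => ?_, hunit⟩
  rw [← LieSubmodule.mem_toSubmodule, heq, LinearMap.mem_ker]

namespace IsHermitian

variable {J : L →ₗ[ℝ] L} {g : L →ₗ[ℝ] L →ₗ[ℝ] ℝ}

theorem apply_left (h : IsHermitian J g) (x y : L) : g (J x) y = -g x (J y) := by
  have := h.compat x (J y)
  rw [h.complex.sq, map_neg] at this
  linarith

theorem apply_self (h : IsHermitian J g) (x : L) : g x (J x) = 0 := by
  have := h.apply_left x x
  rw [h.symm] at this
  linarith

theorem fundamentalForm_map (h : IsHermitian J g) :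
    (fun u v => fundamentalForm J g (J u) (J v)) = fundamentalForm J g := by
  funext u v
  simp only [fundamentalForm, h.compat]

theorem dc₂_eq (h : IsHermitian J g) (x y z : L) :
    dc₂ J (fundamentalForm J g) x y z
      = -g ⁅J x, J y⁆ z + g ⁅J x, J z⁆ y - g ⁅J y, J z⁆ x := by
  rw [dc₂, neg_neg, h.fundamentalForm_map]
  simp only [d₂, fundamentalForm, h.compat]

end IsHermitian

/-! ### Bracket, complex structure and torsion in terms of the unit normal -/

namespace IsUnitNormal

variable {I : LieIdeal ℝ L} {J : L →ₗ[ℝ] L} {g : L →ₗ[ℝ] L →ₗ[ℝ] ℝ} {e : L}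

theorem lie_mem_of_mem (_h : IsUnitNormal I g e) (x : L) {y : L} (hy : y ∈ I) : ⁅x, y⁆ ∈ I :=
  lie_mem_right ℝ L I x y hy

/-- The components of x and y orthogonal to e lie in the abelian ideal, so the whole bracket is
encoded in the single operator ad e. -/
theorem lie_eq (h : IsUnitNormal I g e) (x y : L) :
    ⁅x, y⁆ = g e x • ⁅e, y⁆ - g e y • ⁅e, x⁆ := by
  have hm : ∀ z, z - g e z • e ∈ I := fun z => by
    rw [h.mem_iff]; simp [h.unit]
  have := h.abelian _ (hm x) _ (hm y)
  simp only [sub_lie, lie_sub, smul_lie, lie_smul, lie_self, smul_zero, sub_zero] at this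
  rw [← lie_skew x e] at this
  rw [← sub_eq_zero, ← this]
  simp only [smul_neg]
  abel

theorem apply_lie (h : IsUnitNormal I g e) (x y : L) : g e ⁅x, y⁆ = 0 := by
  have hD : ∀ z, g e ⁅e, z⁆ = 0 := fun z => by
    have hz : z - g e z • e ∈ I := by rw [h.mem_iff]; simp [h.unit]
    have := (h.mem_iff _).1 (h.lie_mem_of_mem e hz)
    simpa using this
  rw [h.lie_eq]
  simp [hD]

theorem apply_J (_h : IsUnitNormal I g e) (hJ : IsHermitian J g) (x : L) :
    g e (J x) = g (-J e) x := by
  rw [map_neg, LinearMap.neg_apply, hJ.apply_left, neg_neg]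

theorem apply_neg_J (_h : IsUnitNormal I g e) (hJ : IsHermitian J g) (x : L) :
    g (-J e) (J x) = -g e x := by
  rw [map_neg, LinearMap.neg_apply, hJ.compat]

theorem neg_J_mem (h : IsUnitNormal I g e) (hJ : IsHermitian J g) : -J e ∈ I := by
  rw [h.mem_iff, map_neg, hJ.apply_self, neg_zero]

theorem neg_J_unit (h : IsUnitNormal I g e) (hJ : IsHermitian J g) : g (-J e) (-J e) = 1 := by
  simp [hJ.compat, h.unit]

/-- On the maximal `J`-invariant subspace of the ideal, `ad e` commutes with `J`. -/
theorem lie_J (h : IsUnitNormal I g e) (hJ : IsHermitian J g) {x : L} (hx : g e x = 0)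
    (hx' : g (-J e) x = 0) : ⁅e, J x⁆ = J ⁅e, x⁆ := by
  have hxI := (h.mem_iff x).2 hx
  have hJxI : J x ∈ I := by rw [h.mem_iff, h.apply_J hJ, hx']
  have hJe : J e ∈ I := by simpa using I.neg_mem (h.neg_J_mem hJ)
  -- The two Nijenhuis terms containing `J e` vanish, because `J e`, x and `J x` all lie in the
  -- abelian ideal.
  have := hJ.complex.nijenhuis e x
  rw [h.abelian _ hJe _ hJxI, h.abelian _ hJe _ hxI] at this
  have h2 : J (J ⁅e, J x⁆) = J (-⁅e, x⁆) := by
    congr 1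
    rw [map_zero] at this
    rw [eq_neg_iff_add_eq_zero, ← neg_eq_zero, ← this]
    abel
  rw [hJ.complex.sq, map_neg] at h2
  exact neg_injective h2

/-- The component of [e, x] along `-J e` is the e-component of J[e, x] = [e, Jx], which is zero.
Hence ad e preserves N. -/
theorem apply_neg_J_lie (h : IsUnitNormal I g e) (hJ : IsHermitian J g) {x : L}
    (hx : g e x = 0) (hx' : g (-J e) x = 0) : g (-J e) ⁅e, x⁆ = 0 := by
  rw [← h.apply_J hJ, ← h.lie_J hJ hx hx', h.apply_lie]

/-- The functional dual to `-J e` is an eigenvector of the transpose of `ad e`. -/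
theorem apply_neg_J_lie_of_mem (h : IsUnitNormal I g e) (hJ : IsHermitian J g) {x : L}
    (hx : g e x = 0) : g (-J e) ⁅e, x⁆ = g (-J e) ⁅e, -J e⁆ * g (-J e) x := by
  -- Subtracting the `-J e` component leaves a vector of N, whose image under ad e stays in N.
  have h1 : g e (x - g (-J e) x • (-J e)) = 0 := by
    have := (h.mem_iff _).1 (h.neg_J_mem hJ)
    rw [map_sub, map_smul, this, hx]; simp
  have h2 : g (-J e) (x - g (-J e) x • (-J e)) = 0 := by
    rw [map_sub, map_smul, h.neg_J_unit hJ]; simp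
  have := h.apply_neg_J_lie hJ h1 h2
  rw [lie_sub, lie_smul, map_sub, map_smul, smul_eq_mul] at this
  linarith

theorem dc₂_eq (h : IsUnitNormal I g e) (hJ : IsHermitian J g) (x y z : L) :
    dc₂ J (fundamentalForm J g) x y z
      = g (-J e) x * (g ⁅e, J z⁆ y - g ⁅e, J y⁆ z) + g (-J e) y * (g ⁅e, J x⁆ z - g ⁅e, J z⁆ x)
        + g (-J e) z * (g ⁅e, J y⁆ x - g ⁅e, J x⁆ y) := by
  rw [hJ.dc₂_eq, h.lie_eq (J x) (J y), h.lie_eq (J x) (J z), h.lie_eq (J y) (J z),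
    h.apply_J hJ, h.apply_J hJ, h.apply_J hJ]
  simp only [map_sub, map_smul, LinearMap.sub_apply, LinearMap.smul_apply, smul_eq_mul]
  ring

/-- The contraction of `d^c ω` with the unit normal. -/
theorem dc₂_apply (h : IsUnitNormal I g e) (hJ : IsHermitian J g) (x y : L) :
    dc₂ J (fundamentalForm J g) e x y
      = g (-J e) y * g ⁅e, -J e⁆ x - g (-J e) x * g ⁅e, -J e⁆ y := by
  have h0 : g (-J e) e = 0 := by rw [hJ.symm]; exact (h.mem_iff _).1 (h.neg_J_mem hJ)
  rw [h.dc₂_eq hJ, h0, hJ.symm _ e, h.apply_lie, hJ.symm _ e, h.apply_lie]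
  simp only [lie_neg, map_neg, LinearMap.neg_apply]
  ring

/-- The pluriclosed condition, as a condition on `s(u, w) = g([e, u], w) + g(u, [e, w])`. -/
theorem skt (h : IsUnitNormal I g e) (hJ : IsHermitian J g)
    (hskt : ∀ x y z w, d₃ (dc₂ J (fundamentalForm J g)) x y z w = 0) {u w : L}
    (hu : g e u = 0) (hu' : g (-J e) u = 0) (hw : g e w = 0) (hw' : g (-J e) w = 0) :
    g (-J e) ⁅e, -J e⁆ * (g ⁅e, u⁆ w + g u ⁅e, w⁆)
      + (g ⁅e, ⁅e, u⁆⁆ w + g ⁅e, u⁆ ⁅e, w⁆) + (g ⁅e, u⁆ ⁅e, w⁆ + g u ⁅e, ⁅e, w⁆⁆) = 0 := by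
  have hJu : g e (J u) = 0 := by rw [h.apply_J hJ, hu']
  have hJu' : g (-J e) (J u) = 0 := by rw [h.apply_neg_J hJ, hu, neg_zero]
  have hDu := h.apply_lie e u
  have hDu' := h.apply_neg_J_lie hJ hu hu'
  have hDJu' := h.apply_neg_J_lie hJ hJu hJu'
  have hDw := h.apply_lie e w
  have hDw' := h.apply_neg_J_lie hJ hw hw'
  have mem : ∀ {z}, g e z = 0 → z ∈ I := fun hz => (h.mem_iff _).2 hz
  -- Among these four vectors only brackets with e survive. The argument `J u` is used because d^cω
  -- itself inserts a `J`; the two cancel and leave inner products free of `J`.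
  have key := hskt e (-J e) (J u) w
  rw [d₃, h.abelian _ (h.neg_J_mem hJ) _ (mem hJu), h.abelian _ (h.neg_J_mem hJ) _ (mem hw),
    h.abelian _ (mem hJu) _ (mem hw)] at key
  simp only [h.dc₂_eq hJ, h.neg_J_unit hJ, hJu', hw', hDw', hDJu', map_zero, lie_zero,
    LinearMap.zero_apply] at key
  simp only [hJ.complex.sq, h.lie_J hJ hw hw', h.lie_J hJ hu hu', lie_neg, map_neg,
    h.lie_J hJ hDw hDw', hJ.compat, LinearMap.neg_apply] at key
  simp only [hJ.symm u, hJ.symm ⁅e, w⁆ ⁅e, u⁆, lie_neg, map_neg, LinearMap.neg_apply] at key ⊢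
  linarith

end IsUnitNormal

theorem linearIndependent_of_apply_eq {n : ℕ} {g : L →ₗ[ℝ] L →ₗ[ℝ] ℝ} {u : Fin n → L}
    (hu : ∀ i j, g (u i) (u j) = if i = j then 1 else 0) : LinearIndependent ℝ u := by
  rw [Fintype.linearIndependent_iff]
  intro c hc i
  have := congrArg (g (u i)) hc
  simpa [hu] using this

theorem eq_sum_of_apply_eq {n : ℕ} [NeZero n] {g : L →ₗ[ℝ] L →ₗ[ℝ] ℝ} {u : Fin n → L}
    (hu : ∀ i j, g (u i) (u j) = if i = j then 1 else 0) (hn : Module.finrank ℝ L = n) (z : L) :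
    z = ∑ i, g (u i) z • u i := by
  let b := basisOfLinearIndependentOfCardEqFinrank (linearIndependent_of_apply_eq hu)
    (by simp [hn])
  have hz : z = ∑ i, b.repr z i • u i := by
    conv_lhs => rw [← b.sum_repr z]
    simp [b]
  have hc : ∀ i, g (u i) z = b.repr z i := fun i => by
    conv_lhs => rw [hz]
    simp [hu]
  simpa only [hc] using hz

end Hermitian

/-- Here p + iq is the off-diagonal entry of ad e in a unitary triangularisation on N. The last two
equations say that p + iq is killed by a complex number of real part a + 3b + c and imaginary part
±(t - s). -/
theorem eq_zero_of_normality {a b c p q t s : ℝ} (eb : b * (a + 2 * b) = 0)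
    (ec : c * (a + 2 * c) + p ^ 2 + q ^ 2 = 0) (e1 : (a + 3 * b + c) * p + (t - s) * q = 0)
    (e2 : (a + 3 * b + c) * q - (t - s) * p = 0) : p = 0 ∧ q = 0 := by
  have hpq : p ^ 2 + q ^ 2 = 0 := by
    have e3 : (a + 3 * b + c) ^ 2 * (p ^ 2 + q ^ 2) + (t - s) ^ 2 * (p ^ 2 + q ^ 2) = 0 := by
      linear_combination ((a + 3 * b + c) * p + (t - s) * q) * e1
        + ((a + 3 * b + c) * q - (t - s) * p) * e2
    have e4 : (a + 3 * b + c) ^ 2 * (p ^ 2 + q ^ 2) = 0 := by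
      have := mul_nonneg (sq_nonneg (a + 3 * b + c)) (add_nonneg (sq_nonneg p) (sq_nonneg q))
      have := mul_nonneg (sq_nonneg (t - s)) (add_nonneg (sq_nonneg p) (sq_nonneg q))
      linarith
    rcases mul_eq_zero.1 e4 with e5 | e5
    -- With this c, the term c(a + 2c) becomes a² + 9b(a + 2b) = a², so `ec` is a vanishing sum of
    -- squares.
    · have e6 : c = -(a + 3 * b) := by linarith [pow_eq_zero_iff (two_ne_zero) |>.1 e5]
      have e7 : (a + 3 * b) * (a + 6 * b) = a ^ 2 + 9 * (b * (a + 2 * b)) := by ring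
      have e8 : a ^ 2 + p ^ 2 + q ^ 2 = 0 := by
        rw [e6] at ec
        linarith
      linarith [sq_nonneg a, sq_nonneg p, sq_nonneg q]
    · exact e5
  exact ⟨by nlinarith only [hpq, sq_nonneg p, sq_nonneg q],
    by nlinarith only [hpq, sq_nonneg p, sq_nonneg q]⟩

/-! ### Adapted frames: diagonalising ad e over ℂ -/

section Frame

variable {L : Type*} [LieRing L] [LieAlgebra ℝ L]

theorem exists_unit_smul {g : L →ₗ[ℝ] L →ₗ[ℝ] ℝ} (pos : ∀ x, x ≠ 0 → 0 < g x x) {x : L}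
    (hx : x ≠ 0) : ∃ r : ℝ, r ≠ 0 ∧ g (r • x) (r • x) = 1 := by
  have hp := pos x hx
  have hr0 : Real.sqrt (g x x) ≠ 0 := (Real.sqrt_pos.2 hp).ne'
  refine ⟨(Real.sqrt (g x x))⁻¹, inv_ne_zero hr0, ?_⟩
  have hrr : Real.sqrt (g x x) * Real.sqrt (g x x) = g x x := Real.mul_self_sqrt hp.le
  simp only [map_smul, LinearMap.smul_apply, smul_eq_mul]
  generalize Real.sqrt (g x x) = r at *
  rw [← hrr]
  field_simp

theorem exists_ne_zero_orthogonal [FiniteDimensional ℝ L] (g : L →ₗ[ℝ] L →ₗ[ℝ] ℝ) {m : ℕ}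
    (v : Fin m → L) (hm : m < Module.finrank ℝ L) : ∃ z, z ≠ 0 ∧ ∀ i, g (v i) z = 0 := by
  have hker : LinearMap.ker (LinearMap.pi fun i => g (v i)) ≠ ⊥ := by
    apply LinearMap.ker_ne_bot_of_finrank_lt
    simpa using hm
  obtain ⟨z, hz, hz0⟩ := (Submodule.ne_bot_iff _).1 hker
  exact ⟨z, hz0, fun i => congrFun (LinearMap.mem_ker.1 hz) i⟩

namespace IsUnitNormal

variable {I : LieIdeal ℝ L} {J : L →ₗ[ℝ] L} {g : L →ₗ[ℝ] L →ₗ[ℝ] ℝ} {e : L}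

/-- `ad e` has a unit complex eigenvector in the maximal `J`-invariant subspace of the ideal. -/
theorem exists_unit_eigenvector [FiniteDimensional ℝ L] (h : IsUnitNormal I g e)
    (hJ : IsHermitian J g) (hL : 2 < Module.finrank ℝ L) :
    ∃ x, g x x = 1 ∧ g e x = 0 ∧ g (-J e) x = 0 ∧ ∃ b t : ℝ, ⁅e, x⁆ = b • x + t • J x := by
  let N : Submodule ℝ L := LinearMap.ker (g e) ⊓ LinearMap.ker (g (-J e))
  have memN : ∀ {z}, z ∈ N ↔ g e z = 0 ∧ g (-J e) z = 0 := by
    intro z; simp only [N, Submodule.mem_inf, LinearMap.mem_ker]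
  have hNJ : ∀ z ∈ N, J z ∈ N := fun z hz => by
    rw [memN] at hz ⊢
    rw [h.apply_J hJ, h.apply_neg_J hJ, hz.1, hz.2]; simp
  have hNA : ∀ z ∈ N, (LieAlgebra.ad ℝ L e : Module.End ℝ L) z ∈ N := fun z hz => by
    rw [memN] at hz ⊢
    exact ⟨h.apply_lie e z, h.apply_neg_J_lie hJ hz.1 hz.2⟩
  obtain ⟨z, hz0, hz⟩ := exists_ne_zero_orthogonal g ![e, -J e] hL
  have : Nontrivial N := by
    refine ⟨⟨⟨z, memN.2 ⟨hz 0, hz 1⟩⟩, 0, fun hh => hz0 (congrArg Subtype.val hh)⟩⟩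
  obtain ⟨x, hx0, b, t, hx⟩ := exists_complex_eigenvector (J.restrict hNJ)
    (LinearMap.restrict (LieAlgebra.ad ℝ L e : Module.End ℝ L) hNA)
    (fun x => Subtype.ext (hJ.complex.sq x))
    (fun x => Subtype.ext (h.lie_J hJ (memN.1 x.2).1 (memN.1 x.2).2))
  have hx' : ⁅e, (x : L)⁆ = b • (x : L) + t • J x := congrArg Subtype.val hx
  obtain ⟨r, -, hr⟩ := exists_unit_smul hJ.pos (x := (x : L)) (fun hh => hx0 (Subtype.ext hh))
  refine ⟨r • (x : L), hr, ?_, ?_, b, t, ?_⟩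
  · rw [map_smul, (memN.1 x.2).1, smul_zero]
  · rw [map_smul, (memN.1 x.2).2, smul_zero]
  · rw [lie_smul, hx', map_smul, smul_add, smul_comm r b, smul_comm r t]

end IsUnitNormal

/-- A frame adapted to a pluriclosed Hermitian structure: `e` is the unit normal of the ideal, and
`ad e` acts diagonally over `ℂ` on the span of `x, J x, y, J y`. -/
structure IsAdaptedFrame (J : L →ₗ[ℝ] L) (g : L →ₗ[ℝ] L →ₗ[ℝ] ℝ) (e x y : L) (b t c s : ℝ) :
    Prop where
  orthonormal : ∀ i j, g (![-J e, x, J x, y, J y, e] i) (![-J e, x, J x, y, J y, e] j)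
    = if i = j then 1 else 0
  lie_x : ⁅e, x⁆ = b • x + t • J x
  lie_y : ⁅e, y⁆ = c • y + s • J y
  lie_Jx : ⁅e, J x⁆ = b • J x - t • x
  lie_Jy : ⁅e, J y⁆ = c • J y - s • y
  eq_b : b * (g (-J e) ⁅e, -J e⁆ + 2 * b) = 0
  eq_c : c * (g (-J e) ⁅e, -J e⁆ + 2 * c) = 0

namespace IsUnitNormal

variable {I : LieIdeal ℝ L} {J : L →ₗ[ℝ] L} {g : L →ₗ[ℝ] L →ₗ[ℝ] ℝ} {e : L}

theorem frame_orthonormal (h : IsUnitNormal I g e) (hJ : IsHermitian J g) {x y : L}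
    (hxx : g x x = 1) (hyy : g y y = 1) (hex : g e x = 0) (hex' : g (-J e) x = 0)
    (hey : g e y = 0) (hey' : g (-J e) y = 0) (hxy : g x y = 0) (hJxy : g (J x) y = 0)
    (i j : Fin 6) : g (![-J e, x, J x, y, J y, e] i) (![-J e, x, J x, y, J y, e] j)
      = if i = j then 1 else 0 := by
  have hxJy : g x (J y) = 0 := by
    have := hJ.apply_left x y
    linarith
  have heJx : g e (J x) = 0 := by rw [h.apply_J hJ, hex']
  have heJy : g e (J y) = 0 := by rw [h.apply_J hJ, hey']
  have heJx' : g (-J e) (J x) = 0 := by rw [h.apply_neg_J hJ, hex, neg_zero]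
  have heJy' : g (-J e) (J y) = 0 := by rw [h.apply_neg_J hJ, hey, neg_zero]
  have hee' : g e (-J e) = 0 := (h.mem_iff _).1 (h.neg_J_mem hJ)
  have hxJx := hJ.apply_self x
  have hyJy := hJ.apply_self y
  have key : ∀ i j, i ≤ j → g (![-J e, x, J x, y, J y, e] i) (![-J e, x, J x, y, J y, e] j)
    = if i = j then 1 else 0 := by
    have h1 := h.neg_J_unit hJ
    have h2 : g (-J e) e = 0 := by rw [hJ.symm, hee']
    have h3 := h.unit
    intro i j hij
    fin_cases i <;> fin_cases j <;> first
      | exact absurd hij (by decide)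
      | simp only [Fin.mk_zero, Fin.reduceFinMk, Matrix.cons_val, hJ.compat, hJ.symm _ e, if_true,
          Fin.reduceEq, if_false, *]
  rcases le_total i j with hij | hij
  · exact key i j hij
  · rw [hJ.symm, key j i hij]; simp only [eq_comm]

/-- N is a complex plane: take a unit complex eigenvector x and a unit y Hermitian-orthogonal to it.
Then ad e is triangular, and the pluriclosed condition makes it diagonal. -/
theorem exists_isAdaptedFrame (h : IsUnitNormal I g e) (hJ : IsHermitian J g)
    (hskt : ∀ x y z w, d₃ (dc₂ J (fundamentalForm J g)) x y z w = 0)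
    (hL : Module.finrank ℝ L = 6) :
    ∃ (x y : L) (b t c s : ℝ), IsAdaptedFrame J g e x y b t c s := by
  have : FiniteDimensional ℝ L := Module.finite_of_finrank_pos (by omega)
  obtain ⟨x, hxx, hex, hex', b, t, hDx⟩ := h.exists_unit_eigenvector hJ (by omega)
  obtain ⟨y₀, hy₀, hy⟩ := exists_ne_zero_orthogonal g ![e, -J e, x, J x] (by omega)
  obtain ⟨r, -, hyy⟩ := exists_unit_smul hJ.pos hy₀
  have hey : g e (r • y₀) = 0 := by rw [map_smul, show g e y₀ = 0 from hy 0, smul_zero]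
  have hey' : g (-J e) (r • y₀) = 0 := by
    rw [map_smul, show g (-J e) y₀ = 0 from hy 1, smul_zero]
  have hxy : g x (r • y₀) = 0 := by rw [map_smul, show g x y₀ = 0 from hy 2, smul_zero]
  have hJxy : g (J x) (r • y₀) = 0 := by rw [map_smul, show g (J x) y₀ = 0 from hy 3, smul_zero]
  generalize r • y₀ = y at *
  have hxJy : g x (J y) = 0 := by
    have := hJ.apply_left x y
    linarith
  have heJx : g e (J x) = 0 := by rw [h.apply_J hJ, hex']
  have heJy : g e (J y) = 0 := by rw [h.apply_J hJ, hey']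
  have heJx' : g (-J e) (J x) = 0 := by rw [h.apply_neg_J hJ, hex, neg_zero]
  have heJy' : g (-J e) (J y) = 0 := by rw [h.apply_neg_J hJ, hey, neg_zero]
  have hee' : g e (-J e) = 0 := (h.mem_iff _).1 (h.neg_J_mem hJ)
  have hxJx := hJ.apply_self x
  have hyJy := hJ.apply_self y
  have hon := h.frame_orthonormal hJ hxx hyy hex hex' hey hey' hxy hJxy
  have hDJx : ⁅e, J x⁆ = b • J x - t • x := by
    rw [h.lie_J hJ hex hex', hDx, map_add, map_smul, map_smul, hJ.complex.sq, smul_neg,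
      sub_eq_add_neg]
  obtain ⟨p, q, c, s, hDy⟩ : ∃ p q c s : ℝ, ⁅e, y⁆ = p • x + q • J x + c • y + s • J y := by
    refine ⟨g x ⁅e, y⁆, g (J x) ⁅e, y⁆, g y ⁅e, y⁆, g (J y) ⁅e, y⁆,
      (eq_sum_of_apply_eq hon hL ⁅e, y⁆).trans ?_⟩
    rw [Fin.sum_univ_six]
    simp only [Matrix.cons_val, h.apply_lie e y, h.apply_neg_J_lie hJ hey hey']
    rw [zero_smul, zero_smul, zero_add, add_zero]
  have hDJy : ⁅e, J y⁆ = p • J x - q • x + c • J y - s • y := by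
    rw [h.lie_J hJ hey hey', hDy]
    simp only [map_add, map_smul, hJ.complex.sq, smul_neg]
    abel
  have hyx : g y x = 0 := by rw [hJ.symm, hxy]
  have hyJx : g y (J x) = 0 := by rw [hJ.symm, hJxy]
  have hJxx : g (J x) x = 0 := by rw [hJ.symm, hxJx]
  have hJyy : g (J y) y = 0 := by rw [hJ.symm, hyJy]
  have hJyx : g (J y) x = 0 := by rw [hJ.symm, hxJy]
  -- The diagonal pairs yield the quadratic relations for b and c; the pairs (x, y) and (Jx, y)
  -- yield the real and imaginary parts of the linear relation for p + iq.
  have kxx := h.skt hJ hskt hex hex' hex hex'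
  have kyy := h.skt hJ hskt hey hey' hey hey'
  have kxy := h.skt hJ hskt hex hex' hey hey'
  have kJxy := h.skt hJ hskt heJx heJx' hey hey'
  simp only [hDx, hDJx, hDy, hDJy, lie_add, lie_sub, lie_smul, map_add, map_sub, map_smul,
    LinearMap.add_apply, LinearMap.sub_apply, LinearMap.smul_apply, smul_eq_mul, hJ.compat,
    hxx, hyy, hxy, hyx, hJxy, hyJx, hxJx, hyJy, hJxx, hJyy, hxJy, hJyx] at kxx kyy kxy kJxy
  set a := g (-J e) ⁅e, -J e⁆ with ha
  have eb : b * (a + 2 * b) = 0 := by linarith only [kxx]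
  have ec : c * (a + 2 * c) + p ^ 2 + q ^ 2 = 0 := by linarith only [kyy]
  obtain ⟨hp, hq⟩ := eq_zero_of_normality eb ec (t := t) (s := s) (by linarith only [kxy])
    (by linarith only [kJxy])
  refine ⟨x, y, b, t, c, s, hon, hDx, ?_, hDJx, ?_, eb, by rw [hp, hq] at ec; linarith only [ec]⟩
  · rw [hDy, hp, hq]; simp
  · rw [hDJy, hp, hq]; simp

end IsUnitNormal
end Frame
/-! ### Isomorphisms -/

section Transport

variable {L M : Type*} [LieRing L] [LieAlgebra ℝ L] [LieRing M] [LieAlgebra ℝ M]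

theorem IsHermitian.transport (φ : L ≃ₗ⁅ℝ⁆ M) {J : L →ₗ[ℝ] L} {g : L →ₗ[ℝ] L →ₗ[ℝ] ℝ}
    (h : IsHermitian J g) :
    IsHermitian ((φ : L →ₗ[ℝ] M) ∘ₗ J ∘ₗ (φ.symm : M →ₗ[ℝ] L))
      (g.compl₁₂ (φ.symm : M →ₗ[ℝ] L) (φ.symm : M →ₗ[ℝ] L)) where
  complex :=
    { sq := fun x => by simp [h.complex.sq]
      nijenhuis := fun x y => by
        have := congrArg φ (h.complex.nijenhuis (φ.symm x) (φ.symm y))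
        simpa [LieEquiv.map_lie] using this }
  symm := fun x y => h.symm _ _
  pos := fun x hx => h.pos _ fun h0 => hx <| by
    rw [← φ.apply_symm_apply x]
    exact (congrArg φ h0).trans (map_zero φ)
  compat := fun x y => by simp [h.compat]

theorem AdmitsKahler.transport (φ : L ≃ₗ⁅ℝ⁆ M) (h : AdmitsKahler L) : AdmitsKahler M := by
  obtain ⟨J, g, hJ, hd⟩ := h
  refine ⟨_, _, hJ.transport φ, fun x y z => ?_⟩
  have := hd (φ.symm x) (φ.symm y) (φ.symm z)
  simpa [d₂, fundamentalForm, LieEquiv.map_lie] using this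

theorem dc₂_transport (φ : L ≃ₗ⁅ℝ⁆ M) (J : L →ₗ[ℝ] L) (g : L →ₗ[ℝ] L →ₗ[ℝ] ℝ) :
    dc₂ ((φ : L →ₗ[ℝ] M) ∘ₗ J ∘ₗ (φ.symm : M →ₗ[ℝ] L))
      (fundamentalForm ((φ : L →ₗ[ℝ] M) ∘ₗ J ∘ₗ (φ.symm : M →ₗ[ℝ] L))
        (g.compl₁₂ (φ.symm : M →ₗ[ℝ] L) (φ.symm : M →ₗ[ℝ] L)))
      = fun x y z => dc₂ J (fundamentalForm J g) (φ.symm x) (φ.symm y) (φ.symm z) := by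
  funext x y z
  simp [dc₂, d₂, fundamentalForm, LieEquiv.map_lie]

theorem AdmitsSplitGeneralizedKahler.transport (φ : L ≃ₗ⁅ℝ⁆ M)
    (h : AdmitsSplitGeneralizedKahler L) : AdmitsSplitGeneralizedKahler M := by
  obtain ⟨Jp, Jm, g, h, hs⟩ := h
  refine ⟨_, _, _, ⟨h.hermitian_plus.transport φ, h.hermitian_minus.transport φ, ?_, ?_, ?_⟩, ?_⟩
  · intro x y z
    rw [dc₂_transport, dc₂_transport]
    exact h.torsion _ _ _
  · intro x y z w
    rw [dc₂_transport]
    simpa [d₃, LieEquiv.map_lie] using h.skt_plus (φ.symm x) (φ.symm y) (φ.symm z) (φ.symm w)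
  · intro x y z w
    rw [dc₂_transport]
    simpa [d₃, LieEquiv.map_lie] using h.skt_minus (φ.symm x) (φ.symm y) (φ.symm z) (φ.symm w)
  · intro x
    simp [hs]

end Transport

/-! ### Isomorphisms onto and between the models -/

namespace Model

/-- The matrix `p ⊕ (q, t) ⊕ (r, s)`, where `(q, t)` stands for `q` plus `t` times a rotation. -/
abbrev blockMatrix (p q t r s : ℝ) : Matrix (Fin 5) (Fin 5) ℝ :=
  !![p, 0, 0, 0, 0;
     0, q, t, 0, 0;
     0, -t, q, 0, 0;
     0, 0, 0, r, s;
     0, 0, 0, -s, r]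

/-- A linearly independent family with the structure constants of the model. -/
theorem nonempty_equiv_of_basis {L : Type*} [LieRing L] [LieAlgebra ℝ L]
    (hL : Module.finrank ℝ L = 6) {u : Fin 6 → L} (hu : LinearIndependent ℝ u)
    (B : Matrix (Fin 5) (Fin 5) ℝ)
    (hc : ∀ i j : Fin 5, ⁅u i.castSucc, u j.castSucc⁆ = 0)
    (hB : ∀ j : Fin 5, ⁅u 5, u j.castSucc⁆ = ∑ i, B i j • u i.castSucc) :
    Nonempty (L ≃ₗ⁅ℝ⁆ Model B) := by
  let b := basisOfLinearIndependentOfCardEqFinrank hu (by simp [hL])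
  have hb : ∀ i, b i = u i := fun i => by simp [b]
  let f : Model B ≃ₗ[ℝ] L := b.equivFun.symm
  have hf : ∀ x : Model B, f x = ∑ i : Fin 5, x.coord i.castSucc • u i.castSucc
      + x.coord 5 • u 5 := fun x => by
    change b.equivFun.symm x.coord = _
    rw [Module.Basis.equivFun_symm_apply, Fin.sum_univ_castSucc]
    simp only [hb]
    rfl
  have hlie : ∀ x y : Model B, f ⁅x, y⁆ = ⁅f x, f y⁆ := fun x y => by
    have hD : ∀ z : Model B, ⁅u 5, ∑ i : Fin 5, z.coord i.castSucc • u i.castSucc⁆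
        = ∑ i : Fin 5, (∑ j : Fin 5, B i j * z.coord j.castSucc) • u i.castSucc := fun z => by
      simp only [lie_sum, lie_smul, hB, Finset.smul_sum, Finset.sum_smul, smul_smul]
      rw [Finset.sum_comm]
      simp only [mul_comm]
    have h0 : ⁅∑ i : Fin 5, x.coord i.castSucc • u i.castSucc,
        ∑ i : Fin 5, y.coord i.castSucc • u i.castSucc⁆ = 0 := by
      simp [sum_lie, lie_sum, hc]
    rw [hf, hf, hf]
    simp only [add_lie, lie_add, lie_smul, smul_lie, h0, lie_self, smul_zero, hD, add_zero,
      zero_add, coord_lie_castSucc, coord_lie_last, zero_smul]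
    rw [← lie_skew, hD]
    simp only [← Finset.sum_neg_distrib, Finset.smul_sum, smul_smul,
      ← Finset.sum_add_distrib, ← add_smul, ← neg_smul]
    refine Finset.sum_congr rfl fun i _ => ?_
    congr 1
    simp only [Fin.sum_univ_five]
    ring
  exact ⟨LieEquiv.symm { f with map_lie' := fun {x y} => hlie x y }⟩

theorem coord_lie_zero {B : Matrix (Fin 5) (Fin 5) ℝ} (x y : Model B) : ⁅x, y⁆.coord 0 =
    B 0 0 * (x.coord 5 * y.coord 0 - x.coord 0 * y.coord 5)
      + B 0 1 * (x.coord 5 * y.coord 1 - x.coord 1 * y.coord 5)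
      + B 0 2 * (x.coord 5 * y.coord 2 - x.coord 2 * y.coord 5)
      + B 0 3 * (x.coord 5 * y.coord 3 - x.coord 3 * y.coord 5)
      + B 0 4 * (x.coord 5 * y.coord 4 - x.coord 4 * y.coord 5) := by
  refine (coord_lie_castSucc x y 0).trans ?_
  rw [Fin.sum_univ_five]
  simp only [Fin.castSucc_zero, Fin.castSucc_one, Fin.reduceCastSucc]
  ring

theorem coord_lie_one {B : Matrix (Fin 5) (Fin 5) ℝ} (x y : Model B) : ⁅x, y⁆.coord 1 =
    B 1 0 * (x.coord 5 * y.coord 0 - x.coord 0 * y.coord 5)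
      + B 1 1 * (x.coord 5 * y.coord 1 - x.coord 1 * y.coord 5)
      + B 1 2 * (x.coord 5 * y.coord 2 - x.coord 2 * y.coord 5)
      + B 1 3 * (x.coord 5 * y.coord 3 - x.coord 3 * y.coord 5)
      + B 1 4 * (x.coord 5 * y.coord 4 - x.coord 4 * y.coord 5) := by
  refine (coord_lie_castSucc x y 1).trans ?_
  rw [Fin.sum_univ_five]
  simp only [Fin.castSucc_zero, Fin.castSucc_one, Fin.reduceCastSucc]
  ring

theorem coord_lie_two {B : Matrix (Fin 5) (Fin 5) ℝ} (x y : Model B) : ⁅x, y⁆.coord 2 =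
    B 2 0 * (x.coord 5 * y.coord 0 - x.coord 0 * y.coord 5)
      + B 2 1 * (x.coord 5 * y.coord 1 - x.coord 1 * y.coord 5)
      + B 2 2 * (x.coord 5 * y.coord 2 - x.coord 2 * y.coord 5)
      + B 2 3 * (x.coord 5 * y.coord 3 - x.coord 3 * y.coord 5)
      + B 2 4 * (x.coord 5 * y.coord 4 - x.coord 4 * y.coord 5) := by
  refine (coord_lie_castSucc x y 2).trans ?_
  rw [Fin.sum_univ_five]
  simp only [Fin.castSucc_zero, Fin.castSucc_one, Fin.reduceCastSucc]
  ring

theorem coord_lie_three {B : Matrix (Fin 5) (Fin 5) ℝ} (x y : Model B) : ⁅x, y⁆.coord 3 =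
    B 3 0 * (x.coord 5 * y.coord 0 - x.coord 0 * y.coord 5)
      + B 3 1 * (x.coord 5 * y.coord 1 - x.coord 1 * y.coord 5)
      + B 3 2 * (x.coord 5 * y.coord 2 - x.coord 2 * y.coord 5)
      + B 3 3 * (x.coord 5 * y.coord 3 - x.coord 3 * y.coord 5)
      + B 3 4 * (x.coord 5 * y.coord 4 - x.coord 4 * y.coord 5) := by
  refine (coord_lie_castSucc x y 3).trans ?_
  rw [Fin.sum_univ_five]
  simp only [Fin.castSucc_zero, Fin.castSucc_one, Fin.reduceCastSucc]
  ring

theorem coord_lie_four {B : Matrix (Fin 5) (Fin 5) ℝ} (x y : Model B) : ⁅x, y⁆.coord 4 =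
    B 4 0 * (x.coord 5 * y.coord 0 - x.coord 0 * y.coord 5)
      + B 4 1 * (x.coord 5 * y.coord 1 - x.coord 1 * y.coord 5)
      + B 4 2 * (x.coord 5 * y.coord 2 - x.coord 2 * y.coord 5)
      + B 4 3 * (x.coord 5 * y.coord 3 - x.coord 3 * y.coord 5)
      + B 4 4 * (x.coord 5 * y.coord 4 - x.coord 4 * y.coord 5) := by
  refine (coord_lie_castSucc x y 4).trans ?_
  rw [Fin.sum_univ_five]
  simp only [Fin.castSucc_zero, Fin.castSucc_one, Fin.reduceCastSucc]
  ring

theorem ext_six {B : Matrix (Fin 5) (Fin 5) ℝ} {x y : Model B} (h₀ : x.coord 0 = y.coord 0)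
    (h₁ : x.coord 1 = y.coord 1) (h₂ : x.coord 2 = y.coord 2) (h₃ : x.coord 3 = y.coord 3)
    (h₄ : x.coord 4 = y.coord 4) (h₅ : x.coord 5 = y.coord 5) : x = y := by
  ext i
  fin_cases i
  exacts [h₀, h₁, h₂, h₃, h₄, h₅]

theorem exists_coord (B : Matrix (Fin 5) (Fin 5) ℝ) (c : Fin 6 → ℝ) :
    ∃ x : Model B, ∀ i, x.coord i = c i := ⟨c, fun _ => rfl⟩

/-- The model of a matrix depends on the matrix only up to scale. -/
theorem nonempty_equiv_smul (B : Matrix (Fin 5) (Fin 5) ℝ) {c : ℝ} (hc : c ≠ 0) :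
    Nonempty (Model B ≃ₗ⁅ℝ⁆ Model (c • B)) := by
  -- Only the direction transverse to the ideal is rescaled: f₆ is sent to c⁻¹ f₆.
  choose f hf using fun x : Model B => exists_coord (c • B)
    ![x.coord 0, x.coord 1, x.coord 2, x.coord 3, x.coord 4, x.coord 5 / c]
  choose k hk using fun x : Model (c • B) => exists_coord B
    ![x.coord 0, x.coord 1, x.coord 2, x.coord 3, x.coord 4, c * x.coord 5]
  have hadd : ∀ x y, f (x + y) = f x + f y := fun x y => by
    apply ext_six <;> simp only [hf, coord_add, Matrix.cons_val, add_div]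
  have hsmul : ∀ (a : ℝ) x, f (a • x) = a • f x := fun a x => by
    apply ext_six <;> simp only [hf, coord_smul, Matrix.cons_val, mul_div_assoc]
  have hlie : ∀ x y, f ⁅x, y⁆ = ⁅f x, f y⁆ := fun x y => by
    apply ext_six <;> simp only [hf, coord_lie_zero, coord_lie_one, coord_lie_two,
      coord_lie_three, coord_lie_four, coord_lie_last, Matrix.cons_val, Matrix.smul_apply,
      smul_eq_mul, zero_div] <;> field_simp
  have hkf : ∀ x, k (f x) = x := fun x => by
    apply ext_six <;> simp only [hf, hk, Matrix.cons_val]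
    exact mul_div_cancel₀ _ hc
  have hfk : ∀ x, f (k x) = x := fun x => by
    apply ext_six <;> simp only [hf, hk, Matrix.cons_val]
    exact mul_div_cancel_left₀ _ hc
  exact ⟨⟨⟨⟨⟨f, hadd⟩, hsmul⟩, fun {x y} => hlie x y⟩, k, hkf, hfk⟩⟩

/-- The isomorphism permutes the basis, exchanging the planes ⟨f₂, f₃⟩ and ⟨f₄, f₅⟩. -/
theorem nonempty_equiv_swap (p q t r s : ℝ) :
    Nonempty (Model (blockMatrix p q t r s) ≃ₗ⁅ℝ⁆ Model (blockMatrix p r s q t)) := by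
  choose f hf using fun x : Model (blockMatrix p q t r s) => exists_coord (blockMatrix p r s q t)
    ![x.coord 0, x.coord 3, x.coord 4, x.coord 1, x.coord 2, x.coord 5]
  choose k hk using fun x : Model (blockMatrix p r s q t) => exists_coord (blockMatrix p q t r s)
    ![x.coord 0, x.coord 3, x.coord 4, x.coord 1, x.coord 2, x.coord 5]
  have hadd : ∀ x y, f (x + y) = f x + f y := fun x y => by
    apply ext_six <;> simp only [hf, coord_add, Matrix.cons_val]
  have hsmul : ∀ (a : ℝ) x, f (a • x) = a • f x := fun a x => by
    apply ext_six <;> simp only [hf, coord_smul, Matrix.cons_val]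
  have hlie : ∀ x y, f ⁅x, y⁆ = ⁅f x, f y⁆ := fun x y => by
    apply ext_six <;> simp [hf, coord_lie_zero, coord_lie_one, coord_lie_two,
      coord_lie_three, coord_lie_four]
  have hkf : ∀ x, k (f x) = x := fun x => by
    apply ext_six <;> simp only [hf, hk, Matrix.cons_val]
  have hfk : ∀ x, f (k x) = x := fun x => by
    apply ext_six <;> simp only [hf, hk, Matrix.cons_val]
  exact ⟨⟨⟨⟨⟨f, hadd⟩, hsmul⟩, fun {x y} => hlie x y⟩, k, hkf, hfk⟩⟩

end Model

/-! ### Explicit structures on the block models -/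

namespace Model

section Structure

variable {B : Matrix (Fin 5) (Fin 5) ℝ} (x y : Model B)

theorem coord_Jplus_zero : (Jplus x).coord 0 = -x.coord 5 := by
  change Matrix.mulVec _ x.coord 0 = _
  simp [Matrix.mulVec, dotProduct, Fin.sum_univ_six]

theorem coord_Jplus_one : (Jplus x).coord 1 = -x.coord 2 := by
  change Matrix.mulVec _ x.coord 1 = _
  simp [Matrix.mulVec, dotProduct, Fin.sum_univ_six]

theorem coord_Jplus_two : (Jplus x).coord 2 = x.coord 1 := by
  change Matrix.mulVec _ x.coord 2 = _
  simp [Matrix.mulVec, dotProduct, Fin.sum_univ_six]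

theorem coord_Jplus_three : (Jplus x).coord 3 = -x.coord 4 := by
  change Matrix.mulVec _ x.coord 3 = _
  simp [Matrix.mulVec, dotProduct, Fin.sum_univ_six]

theorem coord_Jplus_four : (Jplus x).coord 4 = x.coord 3 := by
  change Matrix.mulVec _ x.coord 4 = _
  simp [Matrix.mulVec, dotProduct, Fin.sum_univ_six]

theorem coord_Jplus_five : (Jplus x).coord 5 = x.coord 0 := by
  change Matrix.mulVec _ x.coord 5 = _
  simp [Matrix.mulVec, dotProduct, Fin.sum_univ_six]

theorem coord_Jminus_zero : (Jminus x).coord 0 = -x.coord 5 := by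
  change Matrix.mulVec _ x.coord 0 = _
  simp [Matrix.mulVec, dotProduct, Fin.sum_univ_six]

theorem coord_Jminus_one : (Jminus x).coord 1 = x.coord 2 := by
  change Matrix.mulVec _ x.coord 1 = _
  simp [Matrix.mulVec, dotProduct, Fin.sum_univ_six]

theorem coord_Jminus_two : (Jminus x).coord 2 = -x.coord 1 := by
  change Matrix.mulVec _ x.coord 2 = _
  simp [Matrix.mulVec, dotProduct, Fin.sum_univ_six]

theorem coord_Jminus_three : (Jminus x).coord 3 = x.coord 4 := by
  change Matrix.mulVec _ x.coord 3 = _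
  simp [Matrix.mulVec, dotProduct, Fin.sum_univ_six]

theorem coord_Jminus_four : (Jminus x).coord 4 = -x.coord 3 := by
  change Matrix.mulVec _ x.coord 4 = _
  simp [Matrix.mulVec, dotProduct, Fin.sum_univ_six]

theorem coord_Jminus_five : (Jminus x).coord 5 = x.coord 0 := by
  change Matrix.mulVec _ x.coord 5 = _
  simp [Matrix.mulVec, dotProduct, Fin.sum_univ_six]

theorem stdMetric_apply : stdMetric x y = x.coord 0 * y.coord 0 + x.coord 1 * y.coord 1
    + x.coord 2 * y.coord 2 + x.coord 3 * y.coord 3 + x.coord 4 * y.coord 4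
    + x.coord 5 * y.coord 5 := by
  simp [stdMetric, Fin.sum_univ_six]

theorem stdMetric_pos (hx : x ≠ 0) : 0 < stdMetric x x := by
  obtain ⟨i, hi⟩ : ∃ i, x.coord i ≠ 0 := by
    by_contra! hall
    exact hx (Model.ext hall)
  simp only [stdMetric, LinearMap.mk₂_apply]
  exact Finset.sum_pos' (fun j _ => mul_self_nonneg _)
    ⟨i, Finset.mem_univ i, mul_self_pos.2 hi⟩

@[simp] theorem coord_neg (i : Fin 6) : (-x).coord i = -x.coord i := rfl

@[simp] theorem coord_sub (i : Fin 6) : (x - y).coord i = x.coord i - y.coord i := rfl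

end Structure

section Block

variable (p q t r s : ℝ)

/-- Integrability holds because each 2×2 block, a scalar plus a rotation, commutes with the complex
structure of its plane, while f₁ and f₆ span a complex subalgebra. -/
theorem isHermitian_Jplus :
    IsHermitian (L := Model (blockMatrix p q t r s)) Jplus stdMetric where
  complex :=
    { sq := fun x => by
        ext i
        fin_cases i <;> simp [coord_Jplus_zero, coord_Jplus_one, coord_Jplus_two,
          coord_Jplus_three, coord_Jplus_four, coord_Jplus_five]
      nijenhuis := fun x y => by
        ext i
        fin_cases i <;> simp [coord_Jplus_zero, coord_Jplus_one, coord_Jplus_two,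
          coord_Jplus_three, coord_Jplus_four, coord_Jplus_five, coord_lie_zero, coord_lie_one,
          coord_lie_two, coord_lie_three, coord_lie_four] <;> ring }
  symm x y := by simp only [stdMetric_apply]; ring
  pos x hx := stdMetric_pos x hx
  compat x y := by
    simp only [stdMetric_apply, coord_Jplus_zero, coord_Jplus_one, coord_Jplus_two,
      coord_Jplus_three, coord_Jplus_four, coord_Jplus_five]
    ring

theorem isHermitian_Jminus :
    IsHermitian (L := Model (blockMatrix p q t r s)) Jminus stdMetric where
  complex :=
    { sq := fun x => by
        ext i
        fin_cases i <;> simp [coord_Jminus_zero, coord_Jminus_one, coord_Jminus_two,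
          coord_Jminus_three, coord_Jminus_four, coord_Jminus_five]
      nijenhuis := fun x y => by
        ext i
        fin_cases i <;> simp [coord_Jminus_zero, coord_Jminus_one, coord_Jminus_two,
          coord_Jminus_three, coord_Jminus_four, coord_Jminus_five, coord_lie_zero, coord_lie_one,
          coord_lie_two, coord_lie_three, coord_lie_four] <;> ring }
  symm x y := by simp only [stdMetric_apply]; ring
  pos x hx := stdMetric_pos x hx
  compat x y := by
    simp only [stdMetric_apply, coord_Jminus_zero, coord_Jminus_one, coord_Jminus_two,
      coord_Jminus_three, coord_Jminus_four, coord_Jminus_five]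
    ring

/-- The 3-form `f^1 ∧ f^i ∧ f^j`. -/
def wedge₃ {B : Matrix (Fin 5) (Fin 5) ℝ} (i j : Fin 6) (x y z : Model B) : ℝ :=
  x.coord 0 * (y.coord i * z.coord j - y.coord j * z.coord i)
    - y.coord 0 * (x.coord i * z.coord j - x.coord j * z.coord i)
    + z.coord 0 * (x.coord i * y.coord j - x.coord j * y.coord i)

/-- Only the real parts q and r of the blocks enter; the rotations t and s preserve the area forms
f²³ and f⁴⁵. -/
theorem dc₂_Jplus : dc₂ (L := Model (blockMatrix p q t r s)) Jplus
    (fundamentalForm Jplus stdMetric)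
      = fun x y z => -2 * q * wedge₃ 1 2 x y z - 2 * r * wedge₃ 3 4 x y z := by
  funext x y z
  rw [(isHermitian_Jplus p q t r s).dc₂_eq]
  simp only [wedge₃, stdMetric_apply, coord_Jplus_zero, coord_Jplus_one, coord_Jplus_two,
    coord_Jplus_three, coord_Jplus_four, coord_Jplus_five, coord_lie_zero, coord_lie_one,
    coord_lie_two, coord_lie_three, coord_lie_four, coord_lie_last, Matrix.of_apply,
    Matrix.cons_val]
  ring

/-- The sign is opposite to that for `Jplus` since ω₋ differs from ω₊ by the sign of both area forms
f²³ and f⁴⁵, the only terms that contribute. -/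
theorem dc₂_Jminus : dc₂ (L := Model (blockMatrix p q t r s)) Jminus
    (fundamentalForm Jminus stdMetric)
      = fun x y z => -(-2 * q * wedge₃ 1 2 x y z - 2 * r * wedge₃ 3 4 x y z) := by
  funext x y z
  rw [(isHermitian_Jminus p q t r s).dc₂_eq]
  simp only [wedge₃, stdMetric_apply, coord_Jminus_zero, coord_Jminus_one, coord_Jminus_two,
    coord_Jminus_three, coord_Jminus_four, coord_Jminus_five, coord_lie_zero, coord_lie_one,
    coord_lie_two, coord_lie_three, coord_lie_four, coord_lie_last, Matrix.of_apply,
    Matrix.cons_val]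
  ring

/-- ad f₆ scales f¹²³ by the trace p + 2q of its block on ⟨f₁, f₂, f₃⟩, so the derivative is a
multiple of (p + 2q) f¹²³⁶. -/
theorem d₃_wedge_one_two (hq : q * (p + 2 * q) = 0)
    (x y z w : Model (blockMatrix p q t r s)) : q * d₃ (wedge₃ 1 2) x y z w = 0 := by
  rcases mul_eq_zero.1 hq with rfl | h
  · exact zero_mul _
  · obtain rfl : p = -2 * q := by linarith
    simp only [d₃, wedge₃, coord_lie_zero, coord_lie_one, coord_lie_two, Matrix.of_apply,
      Matrix.cons_val]
    ring

theorem d₃_wedge_three_four (hr : r * (p + 2 * r) = 0)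
    (x y z w : Model (blockMatrix p q t r s)) : r * d₃ (wedge₃ 3 4) x y z w = 0 := by
  rcases mul_eq_zero.1 hr with rfl | h
  · exact zero_mul _
  · obtain rfl : p = -2 * r := by linarith
    simp only [d₃, wedge₃, coord_lie_zero, coord_lie_three, coord_lie_four, Matrix.of_apply,
      Matrix.cons_val]
    ring

theorem isSplitGeneralizedKahler (hq : q * (p + 2 * q) = 0) (hr : r * (p + 2 * r) = 0) :
    IsSplitGeneralizedKahler (L := Model (blockMatrix p q t r s)) Jplus Jminus stdMetric := by
  refine ⟨⟨isHermitian_Jplus .., isHermitian_Jminus .., ?_, ?_, ?_⟩, ?_⟩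
  · intro x y z
    rw [dc₂_Jplus, dc₂_Jminus, add_neg_cancel]
  · intro x y z w
    have h1 := d₃_wedge_one_two p q t r s hq x y z w
    have h2 := d₃_wedge_three_four p q t r s hr x y z w
    rw [dc₂_Jplus]
    simp only [d₃] at h1 h2 ⊢
    linear_combination -2 * h1 - 2 * h2
  · intro x y z w
    have h1 := d₃_wedge_one_two p q t r s hq x y z w
    have h2 := d₃_wedge_three_four p q t r s hr x y z w
    rw [dc₂_Jminus]
    simp only [d₃] at h1 h2 ⊢
    linear_combination 2 * h1 + 2 * h2
  · intro x
    ext i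
    fin_cases i <;> simp [coord_Jplus_zero, coord_Jplus_one, coord_Jplus_two,
      coord_Jplus_three, coord_Jplus_four, coord_Jplus_five, coord_Jminus_zero, coord_Jminus_one,
      coord_Jminus_two, coord_Jminus_three, coord_Jminus_four, coord_Jminus_five]

/-- Without real parts on the two planes, f²³ and f⁴⁵ are closed, as f¹⁶ always is. -/
theorem admitsKahler_of_skew : AdmitsKahler (Model (blockMatrix p 0 t 0 s)) := by
  refine ⟨Jplus, stdMetric, isHermitian_Jplus .., fun x y z => ?_⟩
  simp only [d₂, fundamentalForm, stdMetric_apply, coord_Jplus_zero, coord_Jplus_one,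
    coord_Jplus_two, coord_Jplus_three, coord_Jplus_four, coord_Jplus_five, coord_lie_zero,
    coord_lie_one, coord_lie_two, coord_lie_three, coord_lie_four, coord_lie_last,
    Matrix.of_apply, Matrix.cons_val]
  ring

end Block

/-- The basis `f₁, …, f₆`. -/
noncomputable def stdBasis (B : Matrix (Fin 5) (Fin 5) ℝ) : Module.Basis (Fin 6) ℝ (Model B) :=
  Module.Basis.ofEquivFun (LinearEquiv.refl ℝ (Fin 6 → ℝ))

theorem coord_stdBasis (B : Matrix (Fin 5) (Fin 5) ℝ) (i j : Fin 6) :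
    (stdBasis B j).coord i = if i = j then 1 else 0 := by
  change (stdBasis B j : Fin 6 → ℝ) i = _
  have : (stdBasis B j : Fin 6 → ℝ) = Pi.single j 1 :=
    Module.Basis.coe_ofEquivFun (LinearEquiv.refl ℝ (Fin 6 → ℝ)) ▸ rfl
  rw [this, Pi.single_apply]

/-! ### Unimodularity and the obstruction to Kähler structures -/

theorem trace_ad {B : Matrix (Fin 5) (Fin 5) ℝ} (x : Model B) :
    LinearMap.trace ℝ (Model B) (LieAlgebra.ad ℝ (Model B) x : Module.End ℝ (Model B))
      = x.coord 5 * B.trace := by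
  rw [LinearMap.trace_eq_matrix_trace ℝ (stdBasis B), Matrix.trace]
  have : ∀ i, ((LinearMap.toMatrix (stdBasis B) (stdBasis B))
      (LieAlgebra.ad ℝ (Model B) x)).diag i = ⁅x, stdBasis B i⁆.coord i := fun i => by
    rw [Matrix.diag_apply, LinearMap.toMatrix_apply]
    rfl
  simp only [this, Fin.sum_univ_six, coord_lie_zero, coord_lie_one, coord_lie_two,
    coord_lie_three, coord_lie_four, coord_lie_last, coord_stdBasis, Matrix.trace,
    Fin.sum_univ_five, Matrix.diag_apply]
  simp
  ring

theorem isUnimodular_iff {B : Matrix (Fin 5) (Fin 5) ℝ} :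
    IsUnimodular (Model B) ↔ B.trace = 0 := by
  refine ⟨fun h => ?_, fun h x => by rw [trace_ad, h, mul_zero]⟩
  have := h (stdBasis B 5)
  rwa [trace_ad, coord_stdBasis, if_pos rfl, one_mul] at this

theorem trace_blockMatrix (p q t r s : ℝ) :
    (blockMatrix p q t r s).trace = p + 2 * q + 2 * r := by
  simp [Matrix.trace, Fin.sum_univ_five]
  ring

theorem eq_sum_stdBasis {B : Matrix (Fin 5) (Fin 5) ℝ} (x : Model B) :
    x = ∑ i, x.coord i • stdBasis B i :=
  ((stdBasis B).sum_repr x).symm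

/-- Closedness makes ω invariant under ad f₆ on the ideal. Since 2q, p + q and q + r are nonzero,
the plane ⟨f₂, f₃⟩ is ω-orthogonal to the ideal, so it pairs only with f₆ and contains a vector in
the radical of ω. -/
theorem not_admitsKahler {p q t r s : ℝ} (hq : q ≠ 0) (hpq : p + q ≠ 0) (hqr : q + r ≠ 0) :
    ¬ AdmitsKahler (Model (blockMatrix p q t r s)) := by
  rintro ⟨J, g, hJ, hd⟩
  set f := stdBasis (blockMatrix p q t r s) with hf
  have hc : ∀ i j, (f j).coord i = if i = j then 1 else 0 := coord_stdBasis _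
  have h0 : ⁅f 5, f 0⁆ = p • f 0 := by
    ext i
    fin_cases i <;> simp [hc, coord_lie_zero, coord_lie_one, coord_lie_two, coord_lie_three,
      coord_lie_four]
  have h1 : ⁅f 5, f 1⁆ = q • f 1 - t • f 2 := by
    ext i
    fin_cases i <;> simp [hc, coord_lie_zero, coord_lie_one, coord_lie_two, coord_lie_three,
      coord_lie_four]
  have h2 : ⁅f 5, f 2⁆ = t • f 1 + q • f 2 := by
    ext i
    fin_cases i <;> simp [hc, coord_lie_zero, coord_lie_one, coord_lie_two, coord_lie_three,
      coord_lie_four]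
  have h3 : ⁅f 5, f 3⁆ = r • f 3 - s • f 4 := by
    ext i
    fin_cases i <;> simp [hc, coord_lie_zero, coord_lie_one, coord_lie_two, coord_lie_three,
      coord_lie_four]
  have h4 : ⁅f 5, f 4⁆ = s • f 3 + r • f 4 := by
    ext i
    fin_cases i <;> simp [hc, coord_lie_zero, coord_lie_one, coord_lie_two, coord_lie_three,
      coord_lie_four]
  have hab : ∀ i j : Fin 6, i ≠ 5 → j ≠ 5 → ⁅f i, f j⁆ = 0 := fun i j hi hj => by
    ext k
    fin_cases k <;> simp [hc, coord_lie_zero, coord_lie_one, coord_lie_two, coord_lie_three,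
      coord_lie_four, hi.symm, hj.symm]
  have hd' : ∀ i j : Fin 6, i ≠ 5 → j ≠ 5 → g (J ⁅f 5, f i⁆) (f j) + g (J (f i)) ⁅f 5, f j⁆ = 0 :=
    fun i j hi hj => by
      have h := hd (f 5) (f i) (f j)
      simp only [d₂, fundamentalForm, hab i j hi hj, map_zero, LinearMap.zero_apply,
        hJ.apply_left ⁅f 5, f j⁆, hJ.symm ⁅f 5, f j⁆] at h
      linarith
  have w0 : ∀ x, g (J x) x = 0 := fun x => by rw [hJ.symm, hJ.apply_self]
  have wanti : ∀ x y, g (J y) x = -g (J x) y := fun x y => by rw [hJ.apply_left, hJ.symm]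
  have k12 := hd' 1 2 (by decide) (by decide)
  have k10 := hd' 1 0 (by decide) (by decide)
  have k20 := hd' 2 0 (by decide) (by decide)
  have k13 := hd' 1 3 (by decide) (by decide)
  have k14 := hd' 1 4 (by decide) (by decide)
  have k23 := hd' 2 3 (by decide) (by decide)
  have k24 := hd' 2 4 (by decide) (by decide)
  simp only [h0, h1, h2, h3, h4, map_add, map_sub, map_smul, LinearMap.add_apply,
    LinearMap.sub_apply, LinearMap.smul_apply, smul_eq_mul, w0] at k12 k10 k20 k13 k14 k23 k24
  have z12 : g (J (f 1)) (f 2) = 0 := by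
    have : q * g (J (f 1)) (f 2) = 0 := by linarith
    exact (mul_eq_zero.1 this).resolve_left hq
  -- The pairings with f₁ solve a homogeneous 2×2 system with determinant (p + q)² + t².
  obtain ⟨z10, z20⟩ : g (J (f 1)) (f 0) = 0 ∧ g (J (f 2)) (f 0) = 0 := by
    have hpos : 0 < (p + q) ^ 2 := by positivity
    constructor
    · have : ((p + q) ^ 2 + t ^ 2) * g (J (f 1)) (f 0) = 0 := by
        linear_combination (p + q) * k10 + t * k20
      exact (mul_eq_zero.1 this).resolve_left (by positivity)
    · have : ((p + q) ^ 2 + t ^ 2) * g (J (f 2)) (f 0) = 0 := by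
        linear_combination (p + q) * k20 - t * k10
      exact (mul_eq_zero.1 this).resolve_left (by positivity)
  -- Weighting the four equations by their unknowns cancels the rotation terms and leaves q + r
  -- times a sum of squares.
  have hsum : g (J (f 1)) (f 3) ^ 2 + g (J (f 1)) (f 4) ^ 2 + g (J (f 2)) (f 3) ^ 2
      + g (J (f 2)) (f 4) ^ 2 = 0 := by
    refine (mul_eq_zero.1 ?_).resolve_left hqr
    linear_combination g (J (f 1)) (f 3) * k13 + g (J (f 1)) (f 4) * k14
      + g (J (f 2)) (f 3) * k23 + g (J (f 2)) (f 4) * k24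
  have z13 : g (J (f 1)) (f 3) = 0 := by
    refine pow_eq_zero_iff two_ne_zero |>.1 (le_antisymm ?_ (sq_nonneg _))
    linarith [sq_nonneg (g (J (f 1)) (f 4)), sq_nonneg (g (J (f 2)) (f 3)),
      sq_nonneg (g (J (f 2)) (f 4))]
  have z14 : g (J (f 1)) (f 4) = 0 := by
    refine pow_eq_zero_iff two_ne_zero |>.1 (le_antisymm ?_ (sq_nonneg _))
    linarith [sq_nonneg (g (J (f 1)) (f 3)), sq_nonneg (g (J (f 2)) (f 3)),
      sq_nonneg (g (J (f 2)) (f 4))]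
  have z23 : g (J (f 2)) (f 3) = 0 := by
    refine pow_eq_zero_iff two_ne_zero |>.1 (le_antisymm ?_ (sq_nonneg _))
    linarith [sq_nonneg (g (J (f 1)) (f 4)), sq_nonneg (g (J (f 1)) (f 3)),
      sq_nonneg (g (J (f 2)) (f 4))]
  have z24 : g (J (f 2)) (f 4) = 0 := by
    refine pow_eq_zero_iff two_ne_zero |>.1 (le_antisymm ?_ (sq_nonneg _))
    linarith [sq_nonneg (g (J (f 1)) (f 4)), sq_nonneg (g (J (f 2)) (f 3)),
      sq_nonneg (g (J (f 1)) (f 3))]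
  have z21 : g (J (f 2)) (f 1) = 0 := by rw [wanti, z12, neg_zero]
  have main : ∀ α β : ℝ, α * g (J (f 1)) (f 5) + β * g (J (f 2)) (f 5) = 0 → α = 0 ∧ β = 0 := by
    intro α β h
    have hv : ∀ z, g (J (α • f 1 + β • f 2)) z = 0 := fun z => by
      rw [eq_sum_stdBasis z, ← hf, Fin.sum_univ_six]
      simp only [map_add, map_smul, LinearMap.add_apply, LinearMap.smul_apply, smul_eq_mul, w0,
        z10, z12, z13, z14, z20, z21, z23, z24]
      linear_combination z.coord 5 * h
    have hv0 : α • f 1 + β • f 2 = 0 := by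
      by_contra hne
      have := hJ.pos _ hne
      rw [← hJ.compat, hv] at this
      exact lt_irrefl _ this
    have c1 := congrArg (fun v => coord v 1) hv0
    have c2 := congrArg (fun v => coord v 2) hv0
    simp [hc] at c1 c2
    exact ⟨c1, c2⟩
  -- This combination is ω-orthogonal to f₆ by construction. Both of its coefficients must vanish,
  -- and then every vector of the plane is in the radical.
  obtain ⟨ha, hb⟩ := main (g (J (f 2)) (f 5)) (-g (J (f 1)) (f 5)) (by ring)
  have := (main 1 1 (by rw [ha, neg_eq_zero.1 hb]; ring)).1
  exact one_ne_zero this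

end Model

/-! ### The classification -/

section Classification

variable {L : Type*} [LieRing L] [LieAlgebra ℝ L]

open Model

/-- In complex notation this solves v = (a - b - it)w, so w = (a - b + it)v / ((a - b)² + t²). -/
theorem exists_shift {a b t v₁ v₂ : ℝ} (hab : a ≠ b) :
    ∃ w₁ w₂ : ℝ, v₁ + b * w₁ - t * w₂ = a * w₁ ∧ v₂ + b * w₂ + t * w₁ = a * w₂ := by
  have h0 : 0 < (a - b) ^ 2 := by
    have := sub_ne_zero.2 hab
    positivity
  have hN : (a - b) ^ 2 + t ^ 2 ≠ 0 := by positivity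
  refine ⟨((a - b) * v₁ - t * v₂) / ((a - b) ^ 2 + t ^ 2),
    ((a - b) * v₂ + t * v₁) / ((a - b) ^ 2 + t ^ 2), ?_, ?_⟩
  · field_simp
    ring
  · field_simp
    ring

namespace IsAdaptedFrame

variable {I : LieIdeal ℝ L} {J : L →ₗ[ℝ] L} {g : L →ₗ[ℝ] L →ₗ[ℝ] ℝ} {e x y : L} {b t c s : ℝ}

/-- The signs of t and s change because the columns of the matrix are the images under ad e, and
`blockMatrix` carries its minus sign below the diagonal. -/
theorem nonempty_equiv (hf : IsAdaptedFrame J g e x y b t c s) (h : IsUnitNormal I g e)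
    (hL : Module.finrank ℝ L = 6) {a w₁ w₂ w₃ w₄ : ℝ}
    (hw : ⁅e, -J e + (w₁ • x + w₂ • J x + w₃ • y + w₄ • J y)⁆
      = a • (-J e + (w₁ • x + w₂ • J x + w₃ • y + w₄ • J y))) :
    Nonempty (L ≃ₗ⁅ℝ⁆ Model (blockMatrix a b (-t) c (-s))) := by
  have ho := hf.orthonormal
  set u₀ : L := -J e + (w₁ • x + w₂ • J x + w₃ • y + w₄ • J y) with hu₀
  have m0 : -J e ∈ I := (h.mem_iff _).2 (ho 5 0)
  have m1 : x ∈ I := (h.mem_iff _).2 (ho 5 1)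
  have m2 : J x ∈ I := (h.mem_iff _).2 (ho 5 2)
  have m3 : y ∈ I := (h.mem_iff _).2 (ho 5 3)
  have m4 : J y ∈ I := (h.mem_iff _).2 (ho 5 4)
  have mu : u₀ ∈ I := I.add_mem m0 (I.add_mem (I.add_mem (I.add_mem (I.smul_mem _ m1)
    (I.smul_mem _ m2)) (I.smul_mem _ m3)) (I.smul_mem _ m4))
  refine nonempty_equiv_of_basis hL (u := ![u₀, x, J x, y, J y, e]) ?_ _ ?_ ?_
  · rw [Fintype.linearIndependent_iff]
    intro k hk
    rw [Fin.sum_univ_six] at hk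
    have key : ∀ i : Fin 6, k 0 * (g (![-J e, x, J x, y, J y, e] i) (-J e)
        + (w₁ * g (![-J e, x, J x, y, J y, e] i) x + w₂ * g (![-J e, x, J x, y, J y, e] i) (J x)
        + w₃ * g (![-J e, x, J x, y, J y, e] i) y + w₄ * g (![-J e, x, J x, y, J y, e] i) (J y)))
        + k 1 * g (![-J e, x, J x, y, J y, e] i) x + k 2 * g (![-J e, x, J x, y, J y, e] i) (J x)
        + k 3 * g (![-J e, x, J x, y, J y, e] i) y + k 4 * g (![-J e, x, J x, y, J y, e] i) (J y)
        + k 5 * g (![-J e, x, J x, y, J y, e] i) e = 0 := fun i => by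
      have := congrArg (g (![-J e, x, J x, y, J y, e] i)) hk
      simp only [Matrix.cons_val, hu₀, map_add, map_smul, smul_eq_mul, map_zero] at this
      exact this
    have key' : ∀ i : Fin 6, k 0 * ((if i = 0 then 1 else 0)
        + (w₁ * (if i = 1 then 1 else 0) + w₂ * (if i = 2 then 1 else 0)
        + w₃ * (if i = 3 then 1 else 0) + w₄ * (if i = 4 then 1 else 0)))
        + k 1 * (if i = 1 then 1 else 0) + k 2 * (if i = 2 then 1 else 0)
        + k 3 * (if i = 3 then 1 else 0) + k 4 * (if i = 4 then 1 else 0)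
        + k 5 * (if i = 5 then 1 else 0) = 0 := fun i => by
      have := key i
      rw [show g (![-J e, x, J x, y, J y, e] i) (-J e) = _ from ho i 0,
        show g (![-J e, x, J x, y, J y, e] i) x = _ from ho i 1,
        show g (![-J e, x, J x, y, J y, e] i) (J x) = _ from ho i 2,
        show g (![-J e, x, J x, y, J y, e] i) y = _ from ho i 3,
        show g (![-J e, x, J x, y, J y, e] i) (J y) = _ from ho i 4,
        show g (![-J e, x, J x, y, J y, e] i) e = _ from ho i 5] at this
      exact this
    have k0 : k 0 = 0 := by simpa using key' 0
    intro i
    have := key' i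
    rw [k0, zero_mul] at this
    fin_cases i
    · exact k0
    all_goals simpa using this
  · have hm : ∀ i : Fin 5, (![u₀, x, J x, y, J y, e] : Fin 6 → L) i.castSucc ∈ I := fun i => by
      fin_cases i
      exacts [mu, m1, m2, m3, m4]
    exact fun i j => h.abelian _ (hm i) _ (hm j)
  · intro j
    rw [Fin.sum_univ_five]
    fin_cases j
    · simpa [blockMatrix] using hw
    · simpa [blockMatrix] using hf.lie_x
    · simpa [blockMatrix, sub_eq_neg_add] using hf.lie_Jx
    · simpa [blockMatrix] using hf.lie_y
    · simpa [blockMatrix, sub_eq_neg_add] using hf.lie_Jy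

/-- Since b and c are 0 or -a/2 with a ≠ 0, neither equals a. So ad e - a is invertible on N, and
`-J e` can be corrected by N to an eigenvector. -/
theorem nonempty_equiv_of_ne_zero (hf : IsAdaptedFrame J g e x y b t c s)
    (h : IsUnitNormal I g e) (hL : Module.finrank ℝ L = 6)
    (ha : g (-J e) ⁅e, -J e⁆ ≠ 0) :
    Nonempty (L ≃ₗ⁅ℝ⁆ Model (blockMatrix (g (-J e) ⁅e, -J e⁆) b (-t) c (-s))) := by
  have ho := hf.orthonormal
  have hv := eq_sum_of_apply_eq ho hL ⁅e, -J e⁆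
  rw [Fin.sum_univ_six] at hv
  simp only [Matrix.cons_val, h.apply_lie e (-J e), zero_smul, add_zero] at hv
  have hb : g (-J e) ⁅e, -J e⁆ ≠ b := fun hb => by
    have := hf.eq_b
    rw [← hb] at this
    exact ha (by nlinarith only [this])
  have hc : g (-J e) ⁅e, -J e⁆ ≠ c := fun hc => by
    have := hf.eq_c
    rw [← hc] at this
    exact ha (by nlinarith only [this])
  obtain ⟨w₁, w₂, e1, e2⟩ := exists_shift (t := t) (v₁ := g x ⁅e, -J e⁆)
    (v₂ := g (J x) ⁅e, -J e⁆) hb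
  obtain ⟨w₃, w₄, e3, e4⟩ := exists_shift (t := s) (v₁ := g y ⁅e, -J e⁆)
    (v₂ := g (J y) ⁅e, -J e⁆) hc
  refine hf.nonempty_equiv h hL (w₁ := w₁) (w₂ := w₂) (w₃ := w₃) (w₄ := w₄) ?_
  generalize g (-J e) ⁅e, -J e⁆ = a at *
  rw [lie_add, hv]
  simp only [lie_add, lie_smul, hf.lie_x, hf.lie_Jx, hf.lie_y, hf.lie_Jy, smul_add, smul_smul,
    ← e1, ← e2, ← e3, ← e4]
  module

/-- If the frame has no real parts, `ad e` is skew up to its value on `-J e`. -/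
theorem apply_lie_add_apply_lie (hf : IsAdaptedFrame J g e x y 0 t 0 s)
    (hJ : IsHermitian J g) (hL : Module.finrank ℝ L = 6) (z z' : L) :
    g ⁅e, z⁆ z' + g z ⁅e, z'⁆
      = g (-J e) z * g ⁅e, -J e⁆ z' + g (-J e) z' * g ⁅e, -J e⁆ z := by
  have hD : ∀ z, ⁅e, z⁆ = g (-J e) z • ⁅e, -J e⁆ + (t * g x z) • J x - (t * g (J x) z) • x
      + (s * g y z) • J y - (s * g (J y) z) • y := fun z => by
    have hz := eq_sum_of_apply_eq hf.orthonormal hL z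
    rw [Fin.sum_univ_six] at hz
    simp only [Matrix.cons_val] at hz
    conv_lhs => rw [hz]
    rw [lie_add, lie_add, lie_add, lie_add, lie_add]
    simp only [lie_smul, hf.lie_x, hf.lie_y, hf.lie_Jx, hf.lie_Jy, lie_self]
    module
  rw [hJ.symm z, hD z, hD z']
  simp only [map_add, map_sub, map_smul, LinearMap.add_apply, LinearMap.sub_apply,
    LinearMap.smul_apply, smul_eq_mul]
  ring

end IsAdaptedFrame

/-- If `ad e` is skew up to its value on `-J₊ e`, opposite torsions force `[e, -J₊ e] = 0`. -/
theorem IsUnitNormal.lie_neg_J_eq_zero {I : LieIdeal ℝ L} {Jp Jm : L →ₗ[ℝ] L}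
    {g : L →ₗ[ℝ] L →ₗ[ℝ] ℝ} {e : L} (h : IsUnitNormal I g e) (hG : IsGeneralizedKahler Jp Jm g)
    (ha : g (-Jp e) ⁅e, -Jp e⁆ = 0)
    (hs : ∀ z z', g ⁅e, z⁆ z' + g z ⁅e, z'⁆
      = g (-Jp e) z * g ⁅e, -Jp e⁆ z' + g (-Jp e) z' * g ⁅e, -Jp e⁆ z) :
    ⁅e, -Jp e⁆ = 0 := by
  have hp := hG.hermitian_plus
  have hm := hG.hermitian_minus
  -- Contracting the torsion condition with e gives e₁ ∧ De₁ + f ∧ Df = 0 as covectors, where D = ad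
  -- e, e₁ = -J₊e and f = -J₋e.
  have hT : ∀ z z', g (-Jp e) z' * g ⁅e, -Jp e⁆ z - g (-Jp e) z * g ⁅e, -Jp e⁆ z'
      + (g (-Jm e) z' * g ⁅e, -Jm e⁆ z - g (-Jm e) z * g ⁅e, -Jm e⁆ z') = 0 := fun z z' => by
    rw [← h.dc₂_apply hp, ← h.dc₂_apply hm, hG.torsion]
  have hIp : ∀ {z}, g e z = 0 → g (-Jp e) ⁅e, z⁆ = 0 := fun hz => by
    rw [h.apply_neg_J_lie_of_mem hp hz, ha, zero_mul]
  have hIm : ∀ {z}, g e z = 0 → g (-Jm e) ⁅e, z⁆ = g (-Jm e) ⁅e, -Jm e⁆ * g (-Jm e) z :=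
    fun hz => h.apply_neg_J_lie_of_mem hm hz
  have hu := h.neg_J_unit hp
  have hu' := h.neg_J_unit hm
  have he := (h.mem_iff _).1 (h.neg_J_mem hp)
  have he' := (h.mem_iff _).1 (h.neg_J_mem hm)
  have hev := h.apply_lie e (-Jp e)
  generalize -Jp e = e₁ at *
  generalize -Jm e = f at *
  have sy := hp.symm
  by_contra hv
  have hpos := hp.pos _ hv
  have T1 := hT e₁ f
  have T2 := hT e₁ ⁅e, e₁⁆
  have S1 := hs f f
  have S2 := hs f ⁅e, e₁⁆
  have q1 := hIp he'
  have q2 := hIm he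
  have q3 := hIm hev
  rw [sy ⁅e, e₁⁆ e₁, ha, hu, sy f e₁, sy ⁅e, f⁆ e₁, q1, hu', sy ⁅e, f⁆ f] at T1
  rw [ha, sy ⁅e, e₁⁆ e₁, ha, hu, sy ⁅e, f⁆ e₁, q1, sy f e₁] at T2
  rw [sy ⁅e, f⁆ f, sy ⁅e, e₁⁆ f] at S1
  rw [q3, ha] at S2
  rw [sy f e₁] at q2
  rw [sy ⁅e, e₁⁆ f] at T1
  generalize g e₁ f = k at *
  generalize g f ⁅e, f⁆ = α at *
  rw [q2] at S1 T1
  -- With v = De₁, k = g(e₁, f) and α = g(f, Df), the torsion at (e₁, f) reads g(f, v) + αk = 0,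
  -- while g(f, v) = αk.
  have hk : α * k = 0 := by linarith
  -- The symmetric part of D at (f, f) gives α = k g(f, v) = αk².
  have hα : α = 0 := by rw [hk, mul_zero] at S1; linarith
  rw [hα, zero_mul, add_zero, zero_mul, add_zero] at S2
  rw [S2] at T2
  -- Now g(Df, v) = k g(v, v), so the torsion at (e₁, v) becomes (1 + k²) g(v, v) = 0.
  nlinarith [mul_nonneg (sq_nonneg k) hpos.le]

theorem nonempty_equiv_smul_block {p q t r s : ℝ}
    (h : Nonempty (L ≃ₗ⁅ℝ⁆ Model (blockMatrix p q t r s))) {c p' q' t' r' s' : ℝ} (hc : c ≠ 0)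
    (hp : c * p = p') (hq : c * q = q') (ht : c * t = t') (hr : c * r = r') (hs : c * s = s') :
    Nonempty (L ≃ₗ⁅ℝ⁆ Model (blockMatrix p' q' t' r' s')) := by
  obtain ⟨φ⟩ := h
  obtain ⟨ψ⟩ := nonempty_equiv_smul (blockMatrix p q t r s) hc
  have : c • blockMatrix p q t r s = blockMatrix p' q' t' r' s' := by
    subst hp hq ht hr hs
    simp [blockMatrix, Matrix.smul_of]
  exact this ▸ ⟨φ.trans ψ⟩

theorem k1_matrix (p r : ℝ) :
    !![1, 0, 0, 0, 0; 0, p, 0, 0, 0; 0, 0, p, 0, 0; 0, 0, 0, r, 0; 0, 0, 0, 0, r]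
      = blockMatrix 1 p 0 r 0 := by
  simp [blockMatrix]

theorem k8_matrix (p q s : ℝ) :
    !![p, 0, 0, 0, 0; 0, q, 0, 0, 0; 0, 0, q, 0, 0; 0, 0, 0, s, 1; 0, 0, 0, -1, s]
      = blockMatrix p q 0 s 1 := by
  simp [blockMatrix]

theorem k19_matrix (p q : ℝ) :
    !![p, 0, 0, 0, 0; 0, q, 1, 0, 0; 0, -1, q, 0, 0; 0, 0, 0, 0, 0; 0, 0, 0, 0, 0]
      = blockMatrix p q 1 0 0 := by
  simp [blockMatrix]

theorem nonempty_k1_iff (p r : ℝ) :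
    Nonempty (L ≃ₗ⁅ℝ⁆ k1 p r) ↔ Nonempty (L ≃ₗ⁅ℝ⁆ Model (blockMatrix 1 p 0 r 0)) := by
  rw [← k1_matrix]

theorem nonempty_k8_iff (p q s : ℝ) :
    Nonempty (L ≃ₗ⁅ℝ⁆ k8 p q s) ↔ Nonempty (L ≃ₗ⁅ℝ⁆ Model (blockMatrix p q 0 s 1)) := by
  rw [← k8_matrix]

theorem nonempty_k19_iff (p q : ℝ) :
    Nonempty (L ≃ₗ⁅ℝ⁆ k19 p q) ↔ Nonempty (L ≃ₗ⁅ℝ⁆ Model (blockMatrix p q 1 0 0)) := by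
  rw [← k19_matrix]

/-- The seven families are the normal forms of one family of block matrices under rescaling and
exchange of the planes; they are told apart by whether r is 0 or -p/2 and by which of the rotations
t, s vanish. -/
theorem isInList_iff : IsInList L ↔ ∃ p q t r s : ℝ, p ≠ 0 ∧ p + 2 * q = 0 ∧ r * (p + 2 * r) = 0 ∧
    Nonempty (L ≃ₗ⁅ℝ⁆ Model (blockMatrix p q t r s)) := by
  simp only [IsInList, nonempty_k1_iff, nonempty_k8_iff, nonempty_k19_iff]
  constructor
  · rintro (h | ⟨p, hp, h⟩ | ⟨p, hp, h⟩ | ⟨p, s, hp, -, h⟩ | ⟨p, s, hp, -, -, h⟩ | h | ⟨p, hp, h⟩)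
    · exact ⟨_, _, _, _, _, one_ne_zero, by norm_num, by norm_num, h⟩
    · exact ⟨_, _, _, _, _, hp, by ring, by ring, h⟩
    · exact ⟨_, _, _, _, _, hp, by ring, by ring, h⟩
    · exact ⟨_, _, _, _, _, hp, by ring, by ring, h⟩
    · exact ⟨_, _, _, _, _, hp, by ring, by ring, h⟩
    · exact ⟨_, _, _, _, _, one_ne_zero, by norm_num, by norm_num, h⟩
    · exact ⟨_, _, _, _, _, hp, by ring, by ring, h⟩
  · rintro ⟨p, q, t, r, s, hp, hq, hr, h⟩
    obtain rfl : q = -p / 2 := by linarith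
    rcases mul_eq_zero.1 hr with rfl | hr
    -- The matrix is scaled so that a nonzero rotation becomes 1, or p becomes 1 if there is none.
    · by_cases ht : t = 0
      · subst ht
        by_cases hs : s = 0
        · subst hs
          refine Or.inr <| Or.inr <| Or.inr <| Or.inr <| Or.inr <| Or.inl <|
            nonempty_equiv_smul_block h (c := p⁻¹) (inv_ne_zero hp) ?_ ?_ ?_ ?_ ?_ <;>
            field_simp <;> simp
        · refine Or.inr <| Or.inl ⟨s⁻¹ * p, mul_ne_zero (inv_ne_zero hs) hp,
            nonempty_equiv_smul_block h (c := s⁻¹) (inv_ne_zero hs) ?_ ?_ ?_ ?_ ?_⟩ <;>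
            field_simp <;> simp
      · by_cases hs : s = 0
        · subst hs
          refine Or.inr <| Or.inr <| Or.inr <| Or.inr <| Or.inr <| Or.inr
            ⟨t⁻¹ * p, mul_ne_zero (inv_ne_zero ht) hp,
            nonempty_equiv_smul_block h (c := t⁻¹) (inv_ne_zero ht) ?_ ?_ ?_ ?_ ?_⟩ <;>
            field_simp <;> simp
        · refine Or.inr <| Or.inr <| Or.inr <| Or.inl
            ⟨t⁻¹ * p, t⁻¹ * s, mul_ne_zero (inv_ne_zero ht) hp, mul_ne_zero (inv_ne_zero ht) hs,
            nonempty_equiv_smul_block h (c := t⁻¹) (inv_ne_zero ht) ?_ ?_ ?_ ?_ ?_⟩ <;>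
            field_simp <;> simp
    · obtain rfl : r = -p / 2 := by linarith
      have hswap : Nonempty (L ≃ₗ⁅ℝ⁆ Model (blockMatrix p (-p / 2) s (-p / 2) t)) := by
        obtain ⟨φ⟩ := h
        obtain ⟨ψ⟩ := nonempty_equiv_swap p (-p / 2) t (-p / 2) s
        exact ⟨φ.trans ψ⟩
      clear hr
      -- Both planes now have the same real part, so exchanging them exchanges t and s; this
      -- accounts for the bound |s| ≤ 1 in the list.
      wlog hst : |s| ≤ |t| generalizing t s
      · exact this s t hswap h (le_of_not_ge hst)
      by_cases ht : t = 0
      · subst ht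
        obtain rfl : s = 0 := by simpa using hst
        refine Or.inl <|
          nonempty_equiv_smul_block h (c := p⁻¹) (inv_ne_zero hp) ?_ ?_ ?_ ?_ ?_ <;>
            field_simp <;> simp
      · by_cases hs : s = 0
        -- The swapped form is used because `k8` has its rotation in the second plane.
        · subst hs
          refine Or.inr <| Or.inr <| Or.inl ⟨t⁻¹ * p, mul_ne_zero (inv_ne_zero ht) hp,
            nonempty_equiv_smul_block hswap (c := t⁻¹) (inv_ne_zero ht) ?_ ?_ ?_ ?_ ?_⟩ <;>
            field_simp <;> simp
        · refine Or.inr <| Or.inr <| Or.inr <| Or.inr <| Or.inl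
            ⟨t⁻¹ * p, t⁻¹ * s, mul_ne_zero (inv_ne_zero ht) hp,
            abs_pos.2 (mul_ne_zero (inv_ne_zero ht) hs), ?_,
            nonempty_equiv_smul_block h (c := t⁻¹) (inv_ne_zero ht) ?_ ?_ ?_ ?_ ?_⟩
          · rw [abs_mul, abs_inv, inv_mul_le_iff₀ (abs_pos.2 ht), mul_one]
            exact hst
          all_goals field_simp

theorem isInList_of_split (hL : Module.finrank ℝ L = 6) (hA : IsAlmostAbelian L)
    (hG : AdmitsSplitGeneralizedKahler L) (hK : ¬ AdmitsKahler L) : IsInList L := by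
  obtain ⟨I, hI, hq⟩ := hA
  obtain ⟨Jp, Jm, g, hG, -⟩ := hG
  have hp := hG.hermitian_plus
  have : FiniteDimensional ℝ L := Module.finite_of_finrank_pos (by omega)
  obtain ⟨e, he⟩ := exists_isUnitNormal hI hq hp.pos
  obtain ⟨x, y, b, t, c, s, hf⟩ := he.exists_isAdaptedFrame hp hG.skt_plus hL
  have hb := hf.eq_b
  have hc := hf.eq_c
  have hskew : ∀ a, ¬ Nonempty (L ≃ₗ⁅ℝ⁆ Model (blockMatrix a 0 (-t) 0 (-s))) :=
    fun a ⟨φ⟩ => hK ((admitsKahler_of_skew a (-t) (-s)).transport φ.symm)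
  -- When a = 0 both real parts vanish, and the torsion argument leads to a Kähler model.
  by_cases ha : g (-Jp e) ⁅e, -Jp e⁆ = 0
  · exfalso
    rw [ha] at hb hc
    obtain rfl : b = 0 := by simpa using hb
    obtain rfl : c = 0 := by simpa using hc
    have h0 := he.lie_neg_J_eq_zero hG ha (hf.apply_lie_add_apply_lie hp hL)
    refine hskew 0 (hf.nonempty_equiv he hL (a := 0) (w₁ := 0) (w₂ := 0) (w₃ := 0) (w₄ := 0) ?_)
    simpa using h0
  · obtain ⟨φ⟩ := hf.nonempty_equiv_of_ne_zero he hL ha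
    rw [isInList_iff]
    rcases mul_eq_zero.1 hb with rfl | hb'
    · rcases mul_eq_zero.1 hc with rfl | hc'
      · exact absurd ⟨φ⟩ (hskew _)
      -- The plane with nonzero real part is moved to the first position.
      · obtain ⟨ψ⟩ := nonempty_equiv_swap (g (-Jp e) ⁅e, -Jp e⁆) 0 (-t) c (-s)
        exact ⟨_, _, _, _, _, ha, hc', hb, ⟨φ.trans ψ⟩⟩
    · exact ⟨_, _, _, _, _, ha, hb', hc, ⟨φ⟩⟩

theorem admitsSplit_and_not_admitsKahler (h : IsInList L) :
    AdmitsSplitGeneralizedKahler L ∧ ¬ AdmitsKahler L := by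
  obtain ⟨p, q, t, r, s, hp, hq, hr, ⟨φ⟩⟩ := isInList_iff.1 h
  have hq0 : q ≠ 0 := fun h0 => hp (by linarith)
  refine ⟨AdmitsSplitGeneralizedKahler.transport φ.symm
    ⟨_, _, _, isSplitGeneralizedKahler p q t r s (by rw [hq, mul_zero]) hr⟩, fun hK =>
    not_admitsKahler hq0 (fun h0 => hq0 (by linarith)) (fun h0 => ?_) (hK.transport φ)⟩
  rcases mul_eq_zero.1 hr with h1 | h1
  · exact hq0 (by linarith)
  · exact hq0 (by linarith)

theorem split_and_not_kahler_iff (hL : Module.finrank ℝ L = 6) (hA : IsAlmostAbelian L) :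
    (AdmitsSplitGeneralizedKahler L ∧ ¬ AdmitsKahler L) ↔ IsInList L :=
  ⟨fun h => isInList_of_split hL hA h.1 h.2, admitsSplit_and_not_admitsKahler⟩

end Classification

theorem Model.isSplitGeneralizedKahler_of_eq {B : Matrix (Fin 5) (Fin 5) ℝ} {p q t r s : ℝ}
    (hB : B = blockMatrix p q t r s) (hq : q * (p + 2 * q) = 0) (hr : r * (p + 2 * r) = 0) :
    IsSplitGeneralizedKahler (L := Model B) Jplus Jminus stdMetric := by
  subst hB
  exact isSplitGeneralizedKahler p q t r s hq hr

end AlmostAbelian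

/-! ### The main theorem -/

open AlmostAbelian

theorem theorem5p2 :
    -- classification of the Lie groups
    (∀ (G : Type*) [TopologicalSpace G] [ChartedSpace (EuclideanSpace ℝ (Fin 6)) G] [Group G]
        [LieGroup (𝓡 6) ∞ G], IsAlmostAbelianGroup G →
      ((AdmitsLeftInvariantSplitGK G ∧
          ¬ AdmitsLeftInvariantKahler G) ↔
        IsInList (GroupLieAlgebra (𝓡 6) G))) ∧
    -- the same for arbitrary six-dimensional real almost abelian Lie algebras
    (∀ (L : Type*) [LieRing L] [LieAlgebra ℝ L], Module.finrank ℝ L = 6 →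
      IsAlmostAbelian L →
      ((AdmitsSplitGeneralizedKahler L ∧ ¬ AdmitsKahler L) ↔
        IsInList L)) ∧
    -- an explicit split generalized Kähler structure on each member of the list
    (IsSplitGeneralizedKahler (L := k1 (-1 / 2) (-1 / 2))
          Model.Jplus Model.Jminus Model.stdMetric ∧
      (∀ p : ℝ, p ≠ 0 →
        IsSplitGeneralizedKahler (L := k8 p (-p / 2) 0)
          Model.Jplus Model.Jminus Model.stdMetric) ∧
      (∀ p : ℝ, p ≠ 0 →
        IsSplitGeneralizedKahler (L := k8 p (-p / 2) (-p / 2))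
          Model.Jplus Model.Jminus Model.stdMetric) ∧
      (∀ p s : ℝ, p ≠ 0 → s ≠ 0 →
        IsSplitGeneralizedKahler (L := k11 p (-p / 2) 0 s)
          Model.Jplus Model.Jminus Model.stdMetric) ∧
      (∀ p s : ℝ, p ≠ 0 → 0 < |s| → |s| ≤ 1 →
        IsSplitGeneralizedKahler (L := k11 p (-p / 2) (-p / 2) s)
          Model.Jplus Model.Jminus Model.stdMetric) ∧
      IsSplitGeneralizedKahler (L := k17 (-1 / 2))
          Model.Jplus Model.Jminus Model.stdMetric ∧
      (∀ p : ℝ, p ≠ 0 →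
        IsSplitGeneralizedKahler (L := k19 p (-p / 2))
          Model.Jplus Model.Jminus Model.stdMetric)) ∧
    -- unimodularity
    (¬ IsUnimodular (k1 (-1 / 2) (-1 / 2)) ∧
      (∀ p : ℝ, p ≠ 0 → IsUnimodular (k8 p (-p / 2) 0)) ∧
      (∀ p : ℝ, p ≠ 0 → ¬ IsUnimodular (k8 p (-p / 2) (-p / 2))) ∧
      (∀ p s : ℝ, p ≠ 0 → s ≠ 0 → IsUnimodular (k11 p (-p / 2) 0 s)) ∧
      (∀ p s : ℝ, p ≠ 0 → 0 < |s| → |s| ≤ 1 →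
        ¬ IsUnimodular (k11 p (-p / 2) (-p / 2) s)) ∧
      IsUnimodular (k17 (-1 / 2)) ∧
      (∀ p : ℝ, p ≠ 0 → IsUnimodular (k19 p (-p / 2)))) := by
  refine ⟨fun G _ _ _ _ hG => ?_, fun L _ _ hL hA => split_and_not_kahler_iff hL hA, ?_, ?_⟩
  · refine split_and_not_kahler_iff ?_ hG.2
    -- The Lie algebra is the tangent space at the identity, which is the model vector space.
    change Module.finrank ℝ (EuclideanSpace ℝ (Fin 6)) = 6
    simp
  · exact ⟨Model.isSplitGeneralizedKahler_of_eq (k1_matrix _ _) (by norm_num) (by norm_num),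
      fun p _ => Model.isSplitGeneralizedKahler_of_eq (k8_matrix _ _ _) (by ring) (by ring),
      fun p _ => Model.isSplitGeneralizedKahler_of_eq (k8_matrix _ _ _) (by ring) (by ring),
      fun p s _ _ => Model.isSplitGeneralizedKahler p (-p / 2) 1 0 s (by ring) (by ring),
      fun p s _ _ _ => Model.isSplitGeneralizedKahler p (-p / 2) 1 (-p / 2) s (by ring) (by ring),
      -- The matrix of `k17 p` is that of `k1 p 0`.
      Model.isSplitGeneralizedKahler_of_eq (k1_matrix _ _) (by norm_num) (by norm_num),
      fun p _ => Model.isSplitGeneralizedKahler_of_eq (k19_matrix _ _) (by ring) (by ring)⟩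
  · simp only [Model.isUnimodular_iff, k1_matrix, k8_matrix, k19_matrix, Model.trace_blockMatrix]
    exact ⟨by norm_num, fun p _ => by ring, fun p hp h => hp (by linarith), fun p s _ _ => by ring,
      fun p s hp _ _ h => hp (by linarith), by norm_num, fun p _ => by ring⟩
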